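/- For each $l\in\{1,\dots,m\}$ let $(X_{ij}(l))_{i,j\ge 1}$ be an infinite array of complex random variables on a common probability space with $X_{ji}(l)=\overline{X_{ij}(l)}$, such that: the entries $\{X_{ij}(l):1\le i<j\}$ are independent and identically distributed with $E(X_{12}(l))=0$ and $E(|X_{12}(l)|^2)=1$; the (real) diagonal entries $\{X_{ii}(l):i\ge 1\}$ are independent and identically distributed; and the diagonal entries are independent of the entries above the diagonal. Suppose that the $m$ arrays are independent of each other, and that $E(|X_{12}(l)|^4)<\infty$ and $E(X_{11}(l)^2)<\infty$ for every $l$. For $n\ge 1$ let $\mathbf A_n(l)=\frac{1}{\sqrt n}(X_{ij}(l))_{i,j=1}^n$ be the resulting $\mathbf{Wigner}(n,1)$ matrices, and let $\mathrm{tr}_n=\frac1n\mathrm{Tr}$. Then $(\{\mathbf A_n(l)\};\,l=1,\dots,m)$ is asymptotically free, with semicircular limit. That is, there are a unital complex $*$-algebra $\mathcal A$, a linear functional $\tau:\mathcal A\to\mathbb C$ with $\tau(1)=1$, $\tau(a^*)=\overline{\tau(a)}$ and $\tau(a^*a)\ge 0$ for all $a\in\mathcal A$, and selfadjoint elements $a_1,\dots,a_m\in\mathcal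 A$ such that 1. $a_1,\dots,a_m$ are free: for every $k\ge1$, all indices $j_1,\dots,j_k$ with $j_i\ne j_{i+1}$ for $1\le i<k$, and all $b_i$ in the unital subalgebra generated by $a_{j_i}$ with $\tau(b_i)=0$, one has $\tau(b_1b_2\cdots b_k)=0$; 2. every $a_l$ is standard semicircular: $\tau(a_l^r)=\frac1{2\pi}\int_{-2}^{2}x^r\sqrt{4-x^2}\,dx$ for all $r\ge 0$; 3. for every noncommutative polynomial $p$ in $m$ variables with complex coefficients, $$\mathrm{tr}_n\bigl(p(\mathbf A_n(1),\dots,\mathbf A_n(m))\bigr)\longrightarrow\tau\bigl(p(a_1,\dots,a_m)\bigr)\quad\text{almost surely as } n\to\infty.$$ -/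

import Mathlib

open MeasureTheory ProbabilityTheory Filter Topology
open scoped ComplexOrder

noncomputable section

namespace FreeProb

/-! ### Noncommutative probability -/

/-- A state on a unital complex `*`-algebra `𝒜`: a linear functional with `τ 1 = 1`,
`τ (a*) = conj (τ a)` and `τ (a* a) ≥ 0` (in particular real). -/
structure IsState {𝒜 : Type*} [Ring 𝒜] [StarRing 𝒜] [Algebra ℂ 𝒜] (τ : 𝒜 →ₗ[ℂ] ℂ) : Prop where
  map_one : τ 1 = 1
  map_star : ∀ a : 𝒜, τ (star a) = star (τ a)
  nonneg : ∀ a : 𝒜, 0 ≤ τ (star a * a)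

/-- A family of unital subalgebras is free with respect to `τ`: `τ (a₁ ⋯ a_k) = 0` for every
`k ≥ 1` whenever `a_i` lies in the subalgebra of index `j_i`, `τ (a_i) = 0` and consecutive
indices are different. The word is the list of the pairs `(j_i, a_i)`. -/
def FreeSubalgebras {𝒜 : Type*} [Ring 𝒜] [Algebra ℂ 𝒜] (τ : 𝒜 →ₗ[ℂ] ℂ)
    {J : Type*} (S : J → Subalgebra ℂ 𝒜) : Prop :=
  ∀ w : List (J × 𝒜), w ≠ [] →
    w.IsChain (fun x y => x.1 ≠ y.1) →
    (∀ x ∈ w, x.2 ∈ S x.1) → (∀ x ∈ w, τ x.2 = 0) →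
    τ (w.map Prod.snd).prod = 0

/-- Random variables are free if the unital subalgebras that they generate are free. -/
def FreeVariables {𝒜 : Type*} [Ring 𝒜] [Algebra ℂ 𝒜] (τ : 𝒜 →ₗ[ℂ] ℂ)
    {J : Type*} (a : J → 𝒜) : Prop :=
  FreeSubalgebras τ (fun j => Algebra.adjoin ℂ {a j})

/-- The selfadjoint element `a` has the law `ν`: all moments of `ν` exist, and the moments of `a`
with respect to `τ` are those of `ν`. -/
structure HasDistribution {𝒜 : Type*} [Ring 𝒜] [StarRing 𝒜] [Algebra ℂ 𝒜] (τ : 𝒜 →ₗ[ℂ] ℂ)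
    (a : 𝒜) (ν : Measure ℝ) : Prop where
  selfAdjoint : IsSelfAdjoint a
  integrable : ∀ n : ℕ, Integrable (fun x : ℝ => x ^ n) ν
  moment : ∀ n : ℕ, τ (a ^ n) = ((∫ x : ℝ, x ^ n ∂ν : ℝ) : ℂ)

/-- The semicircle law centred at `α` with standard deviation `σ`. -/
def semicircleLaw (α σ : ℝ) : Measure ℝ :=
  volume.withDensity fun x =>
    ENNReal.ofReal ((Set.Icc (α - 2 * σ) (α + 2 * σ)).indicator
      (fun x => 1 / (2 * Real.pi * σ ^ 2) * Real.sqrt (4 * σ ^ 2 - (x - α) ^ 2)) x)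

/-! ### Wigner matrices -/

/-- The normalized trace of an `n × n` matrix. -/
def normTrace {n : ℕ} (A : Matrix (Fin n) (Fin n) ℂ) : ℂ :=
  1 / (n : ℂ) * A.trace

/-- `X` is an infinite Hermitian array of entries of Wigner matrices with off-diagonal variance
`v` (indices start at `0`, so that `X 0 1` is the entry in the first row and second column):
the entries above the diagonal are i.i.d. complex with mean `0` and `E |X 0 1| ^ 2 = v`, the
diagonal entries are i.i.d. (and real, by Hermitian symmetry), and the diagonal is independent of
the family of the entries above it. -/
structure IsWignerArray {Ω : Type*} [MeasurableSpace Ω] (P : Measure Ω)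
    (X : ℕ → ℕ → Ω → ℂ) (v : ℝ) : Prop where
  measurable : ∀ i j, Measurable (X i j)
  hermitian : ∀ i j ω, X j i ω = star (X i j ω)
  indep_upper : iIndepFun (fun (q : {q : ℕ × ℕ // q.1 < q.2}) ω => X q.1.1 q.1.2 ω) P
  ident_upper : ∀ i j, i < j → IdentDistrib (X i j) (X 0 1) P P
  memLp_upper : MemLp (X 0 1) 2 P
  mean_upper : ∫ ω, X 0 1 ω ∂P = 0
  variance_upper : ∫ ω, ‖X 0 1 ω‖ ^ 2 ∂P = v
  indep_diag : iIndepFun (fun (i : ℕ) ω => X i i ω) P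
  ident_diag : ∀ i, IdentDistrib (X i i) (X 0 0) P P
  indep_upper_diag :
    IndepFun (fun ω (q : {q : ℕ × ℕ // q.1 < q.2}) => X q.1.1 q.1.2 ω)
      (fun ω (i : ℕ) => X i i ω) P

/-- The `n`-th Wigner matrix `n ^ (-1/2) (X i j)_{i, j < n}` of the array `X`. -/
def wignerMatrix {Ω : Type*} (X : ℕ → ℕ → Ω → ℂ) (n : ℕ) (ω : Ω) : Matrix (Fin n) (Fin n) ℂ :=
  Matrix.of fun i j => ((1 / Real.sqrt n : ℝ) : ℂ) * X i j ω

end FreeProb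

end

/-! The limit is realised by the operators `creation l + star (creation l)` on the full Fock space,
with the vacuum state. A centred element of the algebra generated by the operator of index `j` sends
the basis vector of any word not starting with `j` into the span of words starting with `j`. An
alternating product of centred elements therefore sends the vacuum to a vector orthogonal to it
(`freeVariables_fockSemicircular`). Each operator is semicircular because both sets of moments obey
the three-term recursion of the Chebyshev polynomials `U`. Finally, the vacuum moment of `l :: u` is
the sum over decompositions `u = u₁ l u₂` of the products of the vacuum moments of `u₁` and `u₂`
(`fockCoeff_cons_nil`, `fockCoeff_cons_eq_splitSum`).

On the matrix side, the entries are truncated at `√n` and the trace of a word is expanded over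
closed walks. Independence factorises each expectation over undirected edges: a loop contributes
`O(n ^ (-1/2))`, another edge used exactly twice `O(n ^ (-1))`, and every remaining edge `O(n ^
(-3/2))` (`IsWignerFamily.norm_integral_fibre_le`). Each distinct vertex brings a factor `n` from
the summation, and a connected graph has at most one more vertex than it has non-loop edges. A loop,
a multiplicity other than two, or a cycle detected by a circulation saves a further half power of
`n` (`Connects.two_mul_card_lt`).

Two consequences follow. The variance of a normalized trace is `O(n ^ (-3/2))`, since only pairs of
walks with a common edge are correlated. And, up to a vanishing error, only walks that reverse their
first step exactly once contribute to the mean; cutting such a walk at the reversal leaves two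
independent closed walks. The expected traces thus satisfy the Fock space recursion in the limit
(`IsWignerFamily.tendsto_integral_wordTrace`). Summable variances give almost sure convergence, and
finite fourth moments off the diagonal, second moments on it, make the truncation eventually
inactive by Borel–Cantelli. -/

noncomputable section

namespace FreeProb

set_option linter.unusedSectionVars false

/-! ### The full Fock space -/

section Fock

variable {J : Type*} [DecidableEq J]

/-- The full Fock space over `ℂ^J`, with orthonormal basis indexed by the words in `J`. -/
abbrev Fock (J : Type*) : Type _ := lp (fun _ : List J => ℂ) 2

/-- The basis vector of the Fock space indexed by a word. -/
def fockVec (w : List J) : Fock J := lp.single 2 w (1 : ℂ)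

lemma inner_fockVec_left (w : List J) (f : Fock J) : inner ℂ (fockVec w) f = f w := by
  simp [fockVec, lp.inner_single_left]

lemma fockVec_apply (w v : List J) : (fockVec w : Fock J) v = if v = w then 1 else 0 := by
  simp [fockVec, lp.single_apply, Pi.single_apply]

lemma inner_fockVec (w v : List J) :
    inner ℂ (fockVec w) (fockVec v) = if w = v then (1 : ℂ) else 0 := by
  rw [inner_fockVec_left, fockVec_apply]

@[simp]
lemma norm_fockVec (w : List J) : ‖(fockVec w : Fock J)‖ = 1 := by
  have h := inner_fockVec w w
  rw [if_pos rfl, inner_self_eq_norm_sq_to_K] at h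
  have h2 : ‖(fockVec w : Fock J)‖ ^ 2 = 1 := Complex.ofReal_injective (by simpa using h)
  exact (pow_eq_one_iff_of_nonneg (norm_nonneg _) two_ne_zero).1 h2

lemma orthonormal_fockVec_cons (j : J) :
    Orthonormal ℂ (fun w : List J => fockVec (j :: w)) := by
  rw [orthonormal_iff_ite]
  intro v w
  simp [inner_fockVec]

/-- The left creation operator. -/
def creation (j : J) : Fock J →L[ℂ] Fock J :=
  (orthonormal_fockVec_cons j).orthogonalFamily.linearIsometry.toContinuousLinearMap

lemma creation_fockVec (j : J) (w : List J) : creation j (fockVec w) = fockVec (j :: w) := by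
  have h := (orthonormal_fockVec_cons j).orthogonalFamily.linearIsometry_apply_single
    (i := w) (1 : ℂ)
  change (orthonormal_fockVec_cons j).orthogonalFamily.linearIsometry (lp.single 2 w (1 : ℂ)) = _
  rw [h]
  simp

lemma fock_ext {f g : Fock J} (h : ∀ w, inner ℂ (fockVec w) f = inner ℂ (fockVec w) g) : f = g := by
  ext w
  simpa [inner_fockVec_left] using h w

lemma annihilation_fockVec_nil (j : J) :
    (creation j).adjoint (fockVec []) = 0 := by
  refine fock_ext fun w => ?_
  rw [ContinuousLinearMap.adjoint_inner_right, creation_fockVec, inner_fockVec]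
  simp

lemma annihilation_fockVec_cons (j i : J) (w : List J) :
    (creation j).adjoint (fockVec (i :: w)) = if i = j then fockVec w else 0 := by
  refine fock_ext fun v => ?_
  rw [ContinuousLinearMap.adjoint_inner_right, creation_fockVec, inner_fockVec]
  split_ifs with h1 h2 h2 <;> simp_all [inner_fockVec]

/-- The semicircular operators on the full Fock space. -/
def fockSemicircular (j : J) : Fock J →L[ℂ] Fock J := creation j + star (creation j)

lemma fockSemicircular_isSelfAdjoint (j : J) : IsSelfAdjoint (fockSemicircular j) :=
  IsSelfAdjoint.add_star_self _

lemma fockSemicircular_fockVec_of_ne (j : J) (w : List J) (h : w.head? ≠ some j) :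
    fockSemicircular j (fockVec w) = fockVec (j :: w) := by
  rcases w with _ | ⟨i, w⟩
  · simp [fockSemicircular, ContinuousLinearMap.star_eq_adjoint, creation_fockVec,
      annihilation_fockVec_nil]
  · have : i ≠ j := by simpa using h
    simp [fockSemicircular, ContinuousLinearMap.star_eq_adjoint, creation_fockVec,
      annihilation_fockVec_cons, this]

lemma fockSemicircular_fockVec_cons (j : J) (w : List J) :
    fockSemicircular j (fockVec (j :: w)) = fockVec (j :: j :: w) + fockVec w := by
  simp [fockSemicircular, ContinuousLinearMap.star_eq_adjoint, creation_fockVec,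
      annihilation_fockVec_cons]

/-- The vacuum state. -/
def vacuumState (J : Type*) [DecidableEq J] : (Fock J →L[ℂ] Fock J) →ₗ[ℂ] ℂ where
  toFun T := inner ℂ (fockVec []) (T (fockVec []))
  map_add' S T := by simp
  map_smul' c T := by simp

lemma vacuumState_apply (T : Fock J →L[ℂ] Fock J) :
    vacuumState J T = inner ℂ (fockVec []) (T (fockVec [])) := rfl

lemma isState_vacuumState : IsState (vacuumState J) where
  map_one := by simp [vacuumState_apply]
  map_star T := by
    rw [vacuumState_apply, vacuumState_apply, ContinuousLinearMap.star_eq_adjoint,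
      ContinuousLinearMap.adjoint_inner_right, ← inner_conj_symm]
    rfl
  nonneg T := by
    rw [vacuumState_apply, mul_apply_eq_comp, ContinuousLinearMap.star_eq_adjoint,
      ContinuousLinearMap.adjoint_inner_right, inner_self_eq_norm_sq_to_K]
    simp

/-! ### Freeness in the vacuum state -/

/-- The linear span inclusion of the vectors `j ^ k w` into the Fock space. -/
def fockLadder (j : J) (w : List J) : (ℕ →₀ ℂ) →ₗ[ℂ] Fock J :=
  Finsupp.linearCombination ℂ fun k => fockVec (List.replicate k j ++ w)

/-- The point is the order of the quantifiers: `T` depends on `b` but not on the base word `w`. What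
`b` does to the vacuum thus determines what it does above every word that does not start with `j`.
-/
lemma exists_ladder_of_mem_adjoin (j : J) (b : Fock J →L[ℂ] Fock J)
    (hb : b ∈ Algebra.adjoin ℂ {fockSemicircular j}) :
    ∃ T : (ℕ →₀ ℂ) →ₗ[ℂ] (ℕ →₀ ℂ), ∀ w : List J, w.head? ≠ some j →
      ∀ x, b (fockLadder j w x) = fockLadder j w (T x) := by
  induction hb using Algebra.adjoin_induction with
  | mem b hb =>
    obtain rfl : b = fockSemicircular j := by simpa using hb
    refine ⟨Finsupp.linearCombination ℂ fun k => Finsupp.single (k + 1) 1 +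
      if k = 0 then 0 else Finsupp.single (k - 1) 1, fun w hw x => ?_⟩
    induction x using Finsupp.induction_linear with
    | zero => simp
    | add f g hf hg => simp only [map_add, hf, hg]
    | single k c =>
      rcases k with _ | k
      · simp [fockLadder, fockSemicircular_fockVec_of_ne j w hw]
      · simp [fockLadder, List.replicate_succ, fockSemicircular_fockVec_cons]
  | algebraMap r => exact ⟨r • LinearMap.id, fun w _ x => by simp [Algebra.algebraMap_eq_smul_one]⟩
  | add a b _ _ ha hb =>
    obtain ⟨S, hS⟩ := ha
    obtain ⟨T, hT⟩ := hb
    exact ⟨S + T, fun w hw x => by simp [hS w hw, hT w hw]⟩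
  | mul a b _ _ ha hb =>
    obtain ⟨S, hS⟩ := ha
    obtain ⟨T, hT⟩ := hb
    exact ⟨S ∘ₗ T, fun w hw x => by simp [hS w hw, hT w hw]⟩

/-- The span of the basis vectors of the words with first letter `j`. -/
def fockStart (j : J) : Submodule ℂ (Fock J) :=
  Submodule.span ℂ (fockVec '' {w | w.head? = some j})

/-- Since `b` acts by the same `T` above every base word, the component of `b (fockVec w)` along
`fockVec w` is the vacuum expectation of `b`, which is zero. Only words with at least one `j` added
remain. -/
lemma apply_fockVec_mem_fockStart (j : J) (b : Fock J →L[ℂ] Fock J)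
    (hb : b ∈ Algebra.adjoin ℂ {fockSemicircular j}) (hτ : vacuumState J b = 0)
    (w : List J) (hw : w.head? ≠ some j) : b (fockVec w) ∈ fockStart j := by
  obtain ⟨T, hT⟩ := exists_ladder_of_mem_adjoin j b hb
  have key (v : List J) (hv : v.head? ≠ some j) :
      b (fockVec v) = fockLadder j v (T (Finsupp.single 0 1)) := by
    rw [← hT v hv]
    simp [fockLadder]
  have h0 : T (Finsupp.single 0 1) 0 = 0 := by
    rw [vacuumState_apply, key [] (by simp), fockLadder, Finsupp.linearCombination_apply,
      Finsupp.sum, inner_sum] at hτ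
    rw [← hτ, Finset.sum_eq_single 0]
    · simp
    · intro k _ hk
      rw [inner_smul_right, inner_fockVec, if_neg, mul_zero]
      simpa using hk
    · intro h
      simp [Finsupp.notMem_support_iff.1 h]
  rw [key w hw, fockLadder, Finsupp.linearCombination_apply, Finsupp.sum]
  refine Submodule.sum_mem _ fun k hk => Submodule.smul_mem _ _ (Submodule.subset_span ⟨_, ?_, rfl⟩)
  rcases k with _ | k
  · simp [h0] at hk
  · simp [List.replicate_succ]

lemma freeVariables_fockSemicircular :
    FreeVariables (vacuumState J) (fockSemicircular (J := J)) := by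
  intro w hw hchain hmem hτ
  -- By induction from the right end of the product: each partial product applied to the vacuum is a
  -- combination of words starting with the index of its leftmost factor, and the next factor has a
  -- different index.
  have key : ∀ w : List (J × (Fock J →L[ℂ] Fock J)),
      w.IsChain (fun x y => x.1 ≠ y.1) →
      (∀ x ∈ w, x.2 ∈ Algebra.adjoin ℂ {fockSemicircular x.1}) →
      (∀ x ∈ w, vacuumState J x.2 = 0) → ∀ x ∈ w.head?,
      (w.map Prod.snd).prod (fockVec []) ∈ fockStart x.1 := by
    intro w
    induction w with
    | nil => simp
    | cons x w ih =>
      intro hc hm ht y hy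
      obtain rfl : x = y := by simpa using hy
      have hx := apply_fockVec_mem_fockStart x.1 x.2 (hm x (by simp)) (ht x (by simp))
      rcases w with _ | ⟨z, w⟩
      · simpa using hx [] (by simp)
      · rw [List.isChain_cons_cons] at hc
        have h := ih hc.2 (fun y hy => hm y (List.mem_cons_of_mem _ hy))
          (fun y hy => ht y (List.mem_cons_of_mem _ hy)) z (by simp)
        rw [List.map_cons, List.prod_cons, mul_apply_eq_comp]
        refine Submodule.span_induction (p := fun v _ => x.2 v ∈ fockStart x.1) ?_ ?_ ?_ ?_ h
        · rintro _ ⟨v, hv, rfl⟩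
          refine hx v ?_
          rw [show v.head? = some z.1 from hv]
          simpa using hc.1.symm
        · simp
        · intro a b _ _ ha hb
          simpa using add_mem ha hb
        · intro c a _ ha
          simpa using Submodule.smul_mem _ c ha
  obtain ⟨x, w, rfl⟩ := List.exists_cons_of_ne_nil hw
  have h := key _ hchain hmem hτ x (by simp)
  rw [vacuumState_apply]
  refine Submodule.span_induction (p := fun v _ => inner ℂ (fockVec []) v = (0 : ℂ)) ?_ ?_ ?_ ?_ h
  · rintro _ ⟨v, hv, rfl⟩
    rw [inner_fockVec, if_neg]
    rintro rfl
    simp at hv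
  · simp
  · intro a b _ _ ha hb
    simp [ha, hb]
  · intro c a _ ha
    simp [ha]

/-! ### The recursion for the vacuum moments -/

/-- The sum of `F u₁ u₂` over all decompositions `u = u₁ l u₂` of the word `u`. -/
def splitSum (l : J) (F : List J → List J → ℂ) : List J → ℂ
  | [] => 0
  | x :: u => (if x = l then F [] u else 0) + splitSum l (fun u₁ u₂ => F (x :: u₁) u₂) u

lemma splitSum_add (l : J) (F G : List J → List J → ℂ) (u : List J) :
    splitSum l (fun u₁ u₂ => F u₁ u₂ + G u₁ u₂) u = splitSum l F u + splitSum l G u := by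
  induction u generalizing F G with
  | nil => simp [splitSum]
  | cons x u ih =>
    simp only [splitSum]
    rw [ih]
    split_ifs <;> ring

lemma splitSum_congr (l : J) {F G : List J → List J → ℂ} (u : List J)
    (h : ∀ u₁ u₂, u₁.length < u.length → u₂.length < u.length → F u₁ u₂ = G u₁ u₂) :
    splitSum l F u = splitSum l G u := by
  induction u generalizing F G with
  | nil => simp [splitSum]
  | cons x u ih =>
    simp only [splitSum]
    rw [h [] u (by simp) (by simp), ih]
    intro u₁ u₂ h₁ h₂
    exact h _ _ (by simpa using h₁) (by simp; omega)

lemma splitSum_zero (l : J) (u : List J) : splitSum l (fun _ _ => 0) u = 0 := by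
  induction u with
  | nil => simp [splitSum]
  | cons x u ih => simp [splitSum, ih]

/-- Both sides sum over the decompositions of `u` into three words separated by a letter `l` and,
further right, a letter `x`. -/
lemma splitSum_splitSum (l x : J) (G : List J → List J → List J → ℂ) (u : List J) :
    splitSum l (fun u₁ u₂ => splitSum x (fun v₁ v₂ => G u₁ v₁ v₂) u₂) u =
      splitSum x (fun u₁ u₂ => splitSum l (fun v₁ v₂ => G v₁ v₂ u₂) u₁) u := by
  induction u generalizing G with
  | nil => simp [splitSum]
  | cons y u ih =>
    simp only [splitSum]
    rw [ih, splitSum_add]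
    by_cases h : y = l
    · simp [h]
    · simp [h, splitSum_zero]

lemma splitSum_eq_sum (l : J) (F : List J → List J → ℂ) (u : List J) :
    splitSum l F u = ∑ q : Fin u.length,
      if u[q] = l then F (u.take q) (u.drop (q + 1)) else 0 := by
  induction u generalizing F with
  | nil => simp [splitSum]
  | cons x u ih =>
    simp only [splitSum]
    rw [ih]
    exact (Fin.sum_univ_succ (fun q : Fin (u.length + 1) => if (x :: u)[q] = l then
      F ((x :: u).take q) ((x :: u).drop (q + 1)) else 0)).symm

/-- The coefficient at the word `v` of a product of semicircular operators applied to the vacuum. -/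
def fockCoeff (u v : List J) : ℂ :=
  inner ℂ (fockVec v) ((u.map fockSemicircular).prod (fockVec []))

lemma fockCoeff_nil (v : List J) : fockCoeff [] v = if v = [] then 1 else 0 := by
  simp [fockCoeff, inner_fockVec]

lemma fockCoeff_cons_nil (l : J) (u : List J) :
    fockCoeff (l :: u) [] = fockCoeff u [l] := by
  rw [fockCoeff, List.map_cons, List.prod_cons, mul_apply_eq_comp,
    ← ContinuousLinearMap.adjoint_inner_left, ← ContinuousLinearMap.star_eq_adjoint,
    (fockSemicircular_isSelfAdjoint l).star_eq, fockSemicircular_fockVec_of_ne l [] (by simp),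
    fockCoeff]

lemma fockCoeff_cons_cons (l x : J) (u v : List J) :
    fockCoeff (l :: u) (x :: v) =
      fockCoeff u (l :: x :: v) + if l = x then fockCoeff u v else 0 := by
  rw [fockCoeff, List.map_cons, List.prod_cons, mul_apply_eq_comp,
    ← ContinuousLinearMap.adjoint_inner_left, ← ContinuousLinearMap.star_eq_adjoint,
    (fockSemicircular_isSelfAdjoint l).star_eq]
  split_ifs with h
  · subst h
    rw [fockSemicircular_fockVec_cons, inner_add_left, fockCoeff, fockCoeff]
  · rw [fockSemicircular_fockVec_of_ne l _ (by simpa using Ne.symm h), fockCoeff, add_zero]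

/-- A last-passage decomposition. The rightmost operators act first: `u₂` builds `v`, the marked
letter creates the `x` that survives, and `u₁` makes an excursion above `x :: v`, whose weight is a
vacuum moment. With `fockCoeff_cons_nil` this closes into a recursion for the vacuum moments. -/
lemma fockCoeff_cons_eq_splitSum (u v : List J) (x : J) :
    fockCoeff u (x :: v) = splitSum x (fun u₁ u₂ => fockCoeff u₁ [] * fockCoeff u₂ v) u := by
  induction hn : u.length using Nat.strong_induction_on generalizing u v x with
  | _ n ih =>
    rcases u with _ | ⟨l, u⟩
    · simp [splitSum, fockCoeff_nil]
    · have hlen : u.length < n := by simp [← hn]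
      rw [fockCoeff_cons_cons, ih _ hlen u (x :: v) l rfl, splitSum]
      -- Peeling off the head `l` and applying induction yields decompositions with two marked
      -- letters. `splitSum_splitSum` matches them with those obtained by expanding `fockCoeff (l ::
      -- u₁) []`.
      have h1 : splitSum l (fun u₁ u₂ => fockCoeff u₁ [] * fockCoeff u₂ (x :: v)) u =
          splitSum l (fun u₁ u₂ => splitSum x
            (fun v₁ v₂ => fockCoeff u₁ [] * fockCoeff v₁ [] * fockCoeff v₂ v) u₂) u := by
        refine splitSum_congr l u fun u₁ u₂ _ h₂ => ?_
        rw [ih _ (h₂.trans hlen) u₂ v x rfl, splitSum_eq_sum, splitSum_eq_sum, Finset.mul_sum]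
        refine Finset.sum_congr rfl fun q _ => ?_
        split_ifs <;> ring
      have h2 : splitSum x (fun u₁ u₂ => fockCoeff (l :: u₁) [] * fockCoeff u₂ v) u =
          splitSum x (fun u₁ u₂ => splitSum l
            (fun v₁ v₂ => fockCoeff v₁ [] * fockCoeff v₂ [] * fockCoeff u₂ v) u₁) u := by
        refine splitSum_congr x u fun u₁ u₂ h₁ _ => ?_
        rw [fockCoeff_cons_nil, ih _ (h₁.trans hlen) u₁ [] l rfl, splitSum_eq_sum, splitSum_eq_sum,
          Finset.sum_mul]
        refine Finset.sum_congr rfl fun q _ => ?_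
        split_ifs <;> ring
      rw [h1, h2, splitSum_splitSum, fockCoeff_nil, add_comm]
      simp

lemma vacuumState_prod (u : List J) :
    vacuumState J (u.map fockSemicircular).prod = fockCoeff u [] := rfl

end Fock

/-! ### The moments of the semicircle law -/

section Semicircle

open Polynomial.Chebyshev in
/-- The integral of `(2 y) ^ r U_k y` against the semicircle density on `[-1, 1]`. -/
def semicircleChebyshev (r k : ℕ) : ℝ :=
  ∫ y in (-1 : ℝ)..1, (2 * y) ^ r * (U ℝ k).eval y * (2 / Real.pi * √(1 - y ^ 2))

-- Since `(1 - y²) U_k = (T_k - T_{k+2}) / 2`, the integral against the semicircle density becomes a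
-- difference of integrals of `T` against the arcsine weight, where only `T_0` survives.
open Polynomial.Chebyshev Polynomial in
lemma semicircleChebyshev_zero (k : ℕ) : semicircleChebyshev 0 k = if k = 0 then 1 else 0 := by
  have h1 : semicircleChebyshev 0 k = ∫ x, (1 / Real.pi * (T ℝ k).eval x -
      1 / Real.pi * (T ℝ ((k + 2 : ℕ) : ℤ)).eval x) ∂measureT := by
    rw [integral_measureT, semicircleChebyshev]
    refine intervalIntegral.integral_congr fun y hy => ?_
    rw [Set.uIcc_of_le (by norm_num)] at hy
    have hy1 : 0 ≤ 1 - y ^ 2 := by nlinarith [hy.1, hy.2]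
    have h2 : (1 - y ^ 2) * √(1 - y ^ 2)⁻¹ = √(1 - y ^ 2) := by
      rcases hy1.eq_or_lt with h | h
      · rw [← h]; simp
      · rw [Real.sqrt_inv]
        field_simp
        exact (Real.sq_sqrt hy1).symm
    have h3 : (1 - y ^ 2) * (U ℝ k).eval y =
        y * (T ℝ (k + 1)).eval y - (T ℝ (k + 2)).eval y := by
      have := congrArg (Polynomial.eval y) (one_sub_X_sq_mul_U_eq_pol_in_T ℝ (k : ℤ))
      simpa using this
    have h4 : (T ℝ (k + 2)).eval y = 2 * y * (T ℝ (k + 1)).eval y - (T ℝ k).eval y := by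
      simp
    have h5 : (T ℝ ((k + 2 : ℕ) : ℤ)).eval y = (T ℝ (k + 2)).eval y := by
      push_cast; rfl
    simp only [pow_zero, one_mul]
    rw [← h2, h5]
    have hp := Real.pi_ne_zero
    field_simp
    linear_combination 2 * √(1 / (1 - y ^ 2)) * h3 - √(1 / (1 - y ^ 2)) * h4
  rw [h1, integral_sub, integral_const_mul, integral_const_mul,
    integral_eval_T_real_measureT_of_ne_zero (n := ((k + 2 : ℕ) : ℤ)) (by omega)]
  · split_ifs with hk
    · subst hk
      have := integral_eval_T_real_measureT_zero
      simp only [Nat.cast_zero]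
      rw [this]
      field_simp
      ring
    · rw [integral_eval_T_real_measureT_of_ne_zero (by exact_mod_cast hk)]
      simp
  · exact (integrable_measureT (Polynomial.continuous _).continuousOn).const_mul _
  · exact (integrable_measureT (Polynomial.continuous _).continuousOn).const_mul _

-- The relation `2 y U_k = U_{k+1} + U_{k-1}` mirrors the action of the semicircular operator on `j
-- ^ k`: one letter is added or one is removed.
open Polynomial.Chebyshev Polynomial in
lemma semicircleChebyshev_succ (r k : ℕ) : semicircleChebyshev (r + 1) k =
    semicircleChebyshev r (k + 1) + if k = 0 then 0 else semicircleChebyshev r (k - 1) := by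
  have hc (r k : ℕ) : IntervalIntegrable
      (fun y : ℝ => (2 * y) ^ r * (U ℝ k).eval y * (2 / Real.pi * √(1 - y ^ 2))) volume (-1) 1 := by
    have := Polynomial.continuous (U ℝ k)
    exact Continuous.intervalIntegrable (by fun_prop) _ _
  have hU (k : ℕ) (y : ℝ) : (U ℝ ((k + 1 + 1 : ℕ) : ℤ)).eval y =
      2 * y * (U ℝ ((k + 1 : ℕ) : ℤ)).eval y - (U ℝ k).eval y := by
    push_cast
    rw [add_assoc]
    simp
  rcases k with _ | k
  · simp only [semicircleChebyshev, if_true, add_zero]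
    refine intervalIntegral.integral_congr fun y _ => ?_
    have h0 : (U ℝ ((0 : ℕ) : ℤ)).eval y = 1 := by simp
    have h1 : (U ℝ ((0 + 1 : ℕ) : ℤ)).eval y = 2 * y := by simp
    simp only [h0, h1]
    ring
  · simp only [semicircleChebyshev, Nat.add_sub_cancel, Nat.succ_ne_zero, if_false]
    rw [← intervalIntegral.integral_add (hc _ _) (hc _ _)]
    refine intervalIntegral.integral_congr fun y _ => ?_
    simp only [hU]
    ring

lemma semicircle_density_eq (x : ℝ) :
    (Set.Icc (0 - 2 * (1 : ℝ)) (0 + 2 * 1)).indicator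
      (fun x => 1 / (2 * Real.pi * 1 ^ 2) * Real.sqrt (4 * 1 ^ 2 - (x - 0) ^ 2)) x =
    1 / (2 * Real.pi) * √(4 - x ^ 2) := by
  by_cases hx : x ∈ Set.Icc (0 - 2 * (1 : ℝ)) (0 + 2 * 1)
  · rw [Set.indicator_of_mem hx]
    norm_num
  · rw [Set.indicator_of_notMem hx, Real.sqrt_eq_zero_of_nonpos, mul_zero]
    by_contra h
    push Not at h
    refine hx ⟨?_, ?_⟩ <;> nlinarith

lemma semicircle_eq_zero_of_notMem {x : ℝ} (hx : x ∉ Set.Ioc (-2 : ℝ) 2) : √(4 - x ^ 2) = 0 := by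
  rw [Real.sqrt_eq_zero_of_nonpos]
  by_contra h
  push Not at h
  refine hx ⟨?_, ?_⟩ <;> nlinarith

lemma semicircleLaw_zero_one :
    semicircleLaw 0 1 = volume.withDensity
      (fun x => ENNReal.ofReal (1 / (2 * Real.pi) * √(4 - x ^ 2))) := by
  simp only [semicircleLaw, semicircle_density_eq]

lemma measurable_semicircle_density :
    Measurable fun x : ℝ => ENNReal.ofReal (1 / (2 * Real.pi) * √(4 - x ^ 2)) := by
  fun_prop

lemma integrable_pow_mul_sqrt (r : ℕ) :
    Integrable (fun x : ℝ => (1 / (2 * Real.pi) * √(4 - x ^ 2)) * x ^ r) := by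
  have h : IntegrableOn (fun x : ℝ => (1 / (2 * Real.pi) * √(4 - x ^ 2)) * x ^ r)
      (Set.Ioc (-2) 2) :=
    (Continuous.integrableOn_Icc (by fun_prop)).mono_set Set.Ioc_subset_Icc_self
  refine h.integrable_of_forall_notMem_eq_zero fun x hx => ?_
  rw [semicircle_eq_zero_of_notMem hx]
  simp

lemma integrable_pow_semicircleLaw (r : ℕ) :
    Integrable (fun x : ℝ => x ^ r) (semicircleLaw 0 1) := by
  rw [semicircleLaw_zero_one, integrable_withDensity_iff_integrable_smul'
    measurable_semicircle_density (by simp)]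
  refine (integrable_pow_mul_sqrt r).congr (Eventually.of_forall fun x => ?_)
  simp only [smul_eq_mul]
  rw [ENNReal.toReal_ofReal (by positivity)]

lemma integral_pow_semicircleLaw (r : ℕ) :
    ∫ x : ℝ, x ^ r ∂(semicircleLaw 0 1) = semicircleChebyshev r 0 := by
  rw [semicircleLaw_zero_one, integral_withDensity_eq_integral_toReal_smul
    measurable_semicircle_density (by simp)]
  have h1 : ∫ x : ℝ, (ENNReal.ofReal (1 / (2 * Real.pi) * √(4 - x ^ 2))).toReal • x ^ r =
      ∫ x in (-2 : ℝ)..2, (1 / (2 * Real.pi) * √(4 - x ^ 2)) * x ^ r := by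
    rw [intervalIntegral.integral_of_le (by norm_num),
      setIntegral_eq_integral_of_forall_compl_eq_zero]
    · refine integral_congr_ae (Eventually.of_forall fun x => ?_)
      simp only [smul_eq_mul]
      rw [ENNReal.toReal_ofReal (by positivity)]
    · intro x hx
      rw [semicircle_eq_zero_of_notMem hx]
      simp
  rw [h1]
  -- The substitution `x = 2 y` carries the density on `[-2, 2]` to the one on `[-1, 1]`.
  have h2 := intervalIntegral.smul_integral_comp_mul_left (a := -1) (b := 1)
    (fun x : ℝ => (1 / (2 * Real.pi) * √(4 - x ^ 2)) * x ^ r) 2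
  norm_num at h2
  norm_num
  rw [← h2, semicircleChebyshev, ← intervalIntegral.integral_const_mul]
  refine intervalIntegral.integral_congr fun y _ => ?_
  have h3 : √(4 - (2 * y) ^ 2) = 2 * √(1 - y ^ 2) := by
    rw [show 4 - (2 * y) ^ 2 = 2 ^ 2 * (1 - y ^ 2) by ring, Real.sqrt_mul (by norm_num),
      Real.sqrt_sq (by norm_num)]
  simp [h3]
  ring

variable {J : Type*} [DecidableEq J]

/-- Under the correspondence of `j ^ k` with `U_k`, both sides satisfy the same recursion in `r`
with the same values at `r = 0`. The moments are the case `k = 0`. -/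
lemma inner_fockSemicircular_pow (j : J) (r k : ℕ) :
    inner ℂ (fockVec []) ((fockSemicircular j ^ r) (fockVec (List.replicate k j))) =
      (semicircleChebyshev r k : ℂ) := by
  induction r generalizing k with
  | zero =>
    rw [semicircleChebyshev_zero, pow_zero, one_apply_eq_self, inner_fockVec]
    rcases k with _ | k <;> simp [List.replicate_succ]
  | succ r ih =>
    rw [semicircleChebyshev_succ, pow_succ, mul_apply_eq_comp]
    rcases k with _ | k
    · have h := fockSemicircular_fockVec_of_ne j [] (by simp)
      have h2 := ih 1
      simp only [List.replicate_one] at h2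
      simp only [List.replicate_zero, h, h2]
      simp
    · rw [List.replicate_succ, fockSemicircular_fockVec_cons, map_add, inner_add_right,
        ← List.replicate_succ, ← List.replicate_succ, ih, ih]
      simp

lemma hasDistribution_fockSemicircular (j : J) :
    HasDistribution (vacuumState J) (fockSemicircular j) (semicircleLaw 0 1) where
  selfAdjoint := fockSemicircular_isSelfAdjoint j
  integrable := integrable_pow_semicircleLaw
  moment r := by
    rw [integral_pow_semicircleLaw, vacuumState_apply]
    exact inner_fockSemicircular_pow j r 0

end Semicircle

/-! ### Independence of the entries -/

/-- The labelled directed edges of the complete graph on `Fin n` with labels in `Fin m`. -/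
abbrev Edge (m n : ℕ) : Type := Fin m × Fin n × Fin n

/-- The labelled undirected edge underlying a directed edge. -/
def Edge.key {m n : ℕ} (e : Edge m n) : Edge m n := (e.1, min e.2.1 e.2.2, max e.2.1 e.2.2)

/-- A family of independent Wigner arrays with the moments needed for almost sure convergence. -/
structure IsWignerFamily {Ω : Type*} [MeasurableSpace Ω] (P : Measure Ω) {m : ℕ}
    (X : Fin m → ℕ → ℕ → Ω → ℂ) : Prop where
  wigner : ∀ l, IsWignerArray P (X l) 1
  indep : iIndepFun (fun (l : Fin m) (ω : Ω) (i j : ℕ) => X l i j ω) P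
  memLp_off : ∀ l, MemLp (X l 0 1) 4 P
  memLp_diag : ∀ l, MemLp (X l 0 0) 2 P

section

variable {Ω : Type*} [MeasurableSpace Ω] {P : Measure Ω} [IsProbabilityMeasure P]

lemma iIndepFun_bool {α : Bool → Type*} [∀ b, MeasurableSpace (α b)] (f : ∀ b, Ω → α b)
    (h : IndepFun (f true) (f false) P) : iIndepFun f P := by
  rw [iIndepFun_iff_measure_inter_preimage_eq_mul]
  intro S B hB
  have hcases : S = ∅ ∨ S = {true} ∨ S = {false} ∨ S = {true, false} := by
    clear hB; revert S; decide
  rcases hcases with rfl | rfl | rfl | rfl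
  · simp
  · simp
  · simp
  · have := h.measure_inter_preimage_eq_mul _ _ (hB true (by simp)) (hB false (by simp))
    rw [Finset.set_biInter_insert, Finset.set_biInter_singleton, Finset.prod_pair (by simp)]
    exact this

lemma IsWignerArray.iIndepFun_le {X : ℕ → ℕ → Ω → ℂ} {v : ℝ} (h : IsWignerArray P X v) :
    iIndepFun (fun (q : {q : ℕ × ℕ // q.1 ≤ q.2}) ω => X q.1.1 q.1.2 ω) P := by
  -- The two independent blocks, upper triangle and diagonal, are indexed by `Bool`. Independence
  -- within and between blocks then combines over the sigma type, into which the pairs `i ≤ j`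
  -- embed.
  let κ : Bool → Type := fun b => if b then {q : ℕ × ℕ // q.1 < q.2} else ℕ
  let idx : (b : Bool) → κ b → ℕ × ℕ := fun b => match b with
    | true => fun q => (q : {q : ℕ × ℕ // q.1 < q.2}).1
    | false => fun i => ((i : ℕ), (i : ℕ))
  have h1 : iIndepFun (fun (p : (b : Bool) × κ b) ω => X (idx p.1 p.2).1 (idx p.1 p.2).2 ω) P := by
    refine iIndepFun_uncurry (X := fun b k ω => X (idx b k).1 (idx b k).2 ω)
      (fun b k => h.measurable _ _) ?_ ?_
    · exact iIndepFun_bool _ h.indep_upper_diag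
    · rintro (_ | _)
      · exact h.indep_diag
      · exact h.indep_upper
  let g : {q : ℕ × ℕ // q.1 ≤ q.2} → (b : Bool) × κ b := fun q =>
    if hq : q.1.1 < q.1.2 then ⟨true, (⟨q.1, hq⟩ : {q : ℕ × ℕ // q.1 < q.2})⟩ else
      ⟨false, (q.1.1 : ℕ)⟩
  have hg (q : {q : ℕ × ℕ // q.1 ≤ q.2}) : idx (g q).1 (g q).2 = q.1 := by
    by_cases hq : q.1.1 < q.1.2
    · have h2 : g q = ⟨true, (⟨q.1, hq⟩ : {q : ℕ × ℕ // q.1 < q.2})⟩ := dif_pos hq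
      rw [h2]
    · have h2 : g q = ⟨false, (q.1.1 : ℕ)⟩ := dif_neg hq
      rw [h2]
      exact Prod.ext rfl (le_antisymm q.2 (not_lt.1 hq))
  have hinj : Function.Injective g := fun a b hab => Subtype.ext (by rw [← hg a, ← hg b, hab])
  have h2 := h1.precomp hinj
  refine h2.congr fun q => Eventually.of_forall fun ω => ?_
  simp only [hg]

lemma IsWignerFamily.iIndepFun_key {m : ℕ} {X : Fin m → ℕ → ℕ → Ω → ℂ} (h : IsWignerFamily P X)
    (n : ℕ) :
    iIndepFun (fun (e : {e : Edge m n // e.2.1 ≤ e.2.2}) ω => X e.1.1 e.1.2.1 e.1.2.2 ω) P := by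
  have h1 : iIndepFun (fun (p : Fin m × {q : ℕ × ℕ // q.1 ≤ q.2}) ω =>
      X p.1 p.2.1.1 p.2.1.2 ω) P := by
    refine iIndepFun_uncurry' (X := fun l (q : {q : ℕ × ℕ // q.1 ≤ q.2}) ω => X l q.1.1 q.1.2 ω)
      (fun l q => (h.wigner l).measurable _ _) ?_ fun l => (h.wigner l).iIndepFun_le
    exact h.indep.comp (fun _ (x : ℕ → ℕ → ℂ) (q : {q : ℕ × ℕ // q.1 ≤ q.2}) => x q.1.1 q.1.2)
      (fun _ => by fun_prop)
  have hinj : Function.Injective (fun e : {e : Edge m n // e.2.1 ≤ e.2.2} =>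
      ((e.1.1, ⟨((e.1.2.1 : ℕ), (e.1.2.2 : ℕ)), e.2⟩) : Fin m × {q : ℕ × ℕ // q.1 ≤ q.2})) := by
    rintro ⟨⟨l, i, j⟩, hij⟩ ⟨⟨l', i', j'⟩, hij'⟩ hab
    simp only [Prod.mk.injEq, Subtype.mk.injEq] at hab ⊢
    exact ⟨hab.1, Fin.ext hab.2.1, Fin.ext hab.2.2⟩
  exact h1.precomp hinj

/-! ### Truncated entries -/

/-- Truncation of a complex number at level `s`. -/
def trunc (s : ℝ) (z : ℂ) : ℂ := if ‖z‖ ≤ s then z else 0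

lemma measurable_trunc (s : ℝ) : Measurable (trunc s) :=
  Measurable.ite (measurableSet_le measurable_norm measurable_const) measurable_id measurable_const

lemma star_trunc (s : ℝ) (z : ℂ) : star (trunc s z) = trunc s (star z) := by
  unfold trunc
  rw [norm_star]
  split_ifs <;> simp

lemma norm_trunc_le (s : ℝ) (hs : 0 ≤ s) (z : ℂ) : ‖trunc s z‖ ≤ s := by
  unfold trunc
  split_ifs with h <;> simp [h, hs]

lemma norm_trunc_le_norm (s : ℝ) (z : ℂ) : ‖trunc s z‖ ≤ ‖z‖ := by
  unfold trunc
  split_ifs <;> simp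

variable {m : ℕ}

/-- The normalized entry, truncated at `√n`, of the Wigner matrix of size `n`. -/
def ent (X : Fin m → ℕ → ℕ → Ω → ℂ) {n : ℕ} (e : Edge m n) (ω : Ω) : ℂ :=
  ((1 / √n : ℝ) : ℂ) * trunc √n (X e.1 e.2.1 e.2.2 ω)

variable {X : Fin m → ℕ → ℕ → Ω → ℂ} {n : ℕ}

lemma Edge.key_of_le {e : Edge m n} (h : e.2.1 ≤ e.2.2) : e.key = e := by
  simp [Edge.key, h]

lemma Edge.key_le (e : Edge m n) : e.key.2.1 ≤ e.key.2.2 := min_le_max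

lemma Edge.key_swap (l : Fin m) (i j : Fin n) :
    Edge.key ((l, i, j) : Edge m n) = Edge.key (l, j, i) := by
  simp [Edge.key, min_comm, max_comm]

lemma Edge.key_of_ge {e : Edge m n} (h : e.2.2 ≤ e.2.1) : e.key = (e.1, e.2.2, e.2.1) := by
  simp [Edge.key, h]

lemma IsWignerFamily.star_ent (h : IsWignerFamily P X) (l : Fin m) (i j : Fin n) (ω : Ω) :
    star (ent X (l, i, j) ω) = ent X (l, j, i) ω := by
  simp only [ent]
  rw [star_mul', star_trunc, ← (h.wigner l).hermitian]
  congr 1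
  exact Complex.conj_ofReal _

/-- Every entry is a function of the entry at its undirected edge, so grouping factors by `Edge.key`
groups them by independent variables. -/
lemma IsWignerFamily.ent_eq (h : IsWignerFamily P X) (e : Edge m n) (ω : Ω) :
    ent X e ω = if e.2.1 ≤ e.2.2 then ent X e.key ω else star (ent X e.key ω) := by
  split_ifs with hle
  · rw [Edge.key_of_le hle]
  · rw [Edge.key_of_ge (not_le.1 hle).le, h.star_ent]

lemma IsWignerFamily.norm_ent_key (h : IsWignerFamily P X) (e : Edge m n) (ω : Ω) :
    ‖ent X e.key ω‖ = ‖ent X e ω‖ := by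
  rw [h.ent_eq e]
  split_ifs
  · rfl
  · rw [norm_star]

lemma IsWignerFamily.measurable_ent (h : IsWignerFamily P X) (e : Edge m n) :
    Measurable (ent X e) :=
  ((measurable_trunc _).comp ((h.wigner _).measurable _ _)).const_mul _

lemma norm_ent (e : Edge m n) (ω : Ω) :
    ‖ent X e ω‖ = 1 / √n * ‖trunc √n (X e.1 e.2.1 e.2.2 ω)‖ := by
  rw [ent, norm_mul, Complex.norm_real, Real.norm_of_nonneg (by positivity)]

/-- The truncation level matches the normalization. Monomials are therefore bounded, and high powers
of an entry can be replaced by low ones. -/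
lemma norm_ent_le_one (e : Edge m n) (ω : Ω) : ‖ent X e ω‖ ≤ 1 := by
  rw [norm_ent]
  have := norm_trunc_le √n (by positivity) (X e.1 e.2.1 e.2.2 ω)
  have hs : 0 ≤ √(n : ℝ) := by positivity
  rcases hs.eq_or_lt with h | h
  · simp [← h]
  · rw [div_mul_eq_mul_div, one_mul]
    exact (div_le_one h).2 this

lemma norm_ent_le (e : Edge m n) (ω : Ω) :
    ‖ent X e ω‖ ≤ 1 / √n * ‖X e.1 e.2.1 e.2.2 ω‖ := by
  rw [norm_ent]
  exact mul_le_mul_of_nonneg_left (norm_trunc_le_norm _ _) (by positivity)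

/-! ### Monomials in the entries and their factorisation -/

variable {ι ι' : Type*} [Fintype ι] [Fintype ι']

/-- The product of the entries along a finite family of edges. -/
def monomial (X : Fin m → ℕ → ℕ → Ω → ℂ) (edge : ι → Edge m n) (ω : Ω) : ℂ :=
  ∏ p, ent X (edge p) ω

/-- The product of the entries along the edges over a given undirected edge. -/
def fibre (X : Fin m → ℕ → ℕ → Ω → ℂ) (edge : ι → Edge m n) (e : Edge m n) (ω : Ω) : ℂ :=
  ∏ p, if (edge p).key = e then ent X (edge p) ω else 1

/-- The undirected edges of a family of edges. -/
def keys (edge : ι → Edge m n) : Finset (Edge m n) := Finset.univ.image fun p => (edge p).key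

lemma mem_keys {edge : ι → Edge m n} {e : Edge m n} : e ∈ keys edge ↔ ∃ p, (edge p).key = e := by
  simp [keys]

lemma key_mem_keys (edge : ι → Edge m n) (p : ι) : (edge p).key ∈ keys edge :=
  mem_keys.2 ⟨p, rfl⟩

lemma IsWignerFamily.measurable_monomial (h : IsWignerFamily P X) (edge : ι → Edge m n) :
    Measurable (monomial X edge) :=
  Finset.measurable_fun_prod _ fun _ _ => h.measurable_ent _

lemma norm_monomial_le_one (edge : ι → Edge m n) (ω : Ω) : ‖monomial X edge ω‖ ≤ 1 := by
  rw [monomial, norm_prod]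
  exact Finset.prod_le_one (fun _ _ => norm_nonneg _) fun _ _ => norm_ent_le_one _ _

lemma IsWignerFamily.integrable_monomial (h : IsWignerFamily P X) (edge : ι → Edge m n) :
    Integrable (monomial X edge) P :=
  Integrable.of_bound (h.measurable_monomial edge).aestronglyMeasurable 1
    (Eventually.of_forall (norm_monomial_le_one edge))

/-- Each fibre is a measurable function, here `f e`, of the single variable at the undirected edge
`e`, and these variables are independent. -/
lemma IsWignerFamily.integral_monomial (h : IsWignerFamily P X) (edge : ι → Edge m n) :
    ∫ ω, monomial X edge ω ∂P = ∏ e ∈ keys edge, ∫ ω, fibre X edge e ω ∂P := by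
  have hle (e : keys edge) : e.1.2.1 ≤ e.1.2.2 := by
    obtain ⟨p, hp⟩ := mem_keys.1 e.2
    rw [← hp]
    exact Edge.key_le _
  let g : keys edge → {e : Edge m n // e.2.1 ≤ e.2.2} := fun e => ⟨e.1, hle e⟩
  have hg : Function.Injective g := fun a b hab => Subtype.ext (congrArg (fun x => x.1) hab)
  let c : ℂ := ((1 / √n : ℝ) : ℂ)
  let f : keys edge → ℂ → ℂ := fun e z => ∏ p, if (edge p).key = e.1 then
    (if (edge p).2.1 ≤ (edge p).2.2 then c * trunc √n z else star (c * trunc √n z)) else 1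
  have hf (e : keys edge) : Measurable (f e) := by
    refine Finset.measurable_fun_prod _ fun p _ => ?_
    have h1 : Measurable fun z => c * trunc √n z := (measurable_trunc _).const_mul c
    have h2 : Measurable fun z => star (c * trunc √n z) :=
      Complex.continuous_conj.measurable.comp h1
    split_ifs
    · exact h1
    · exact h2
    · exact measurable_const
  have hff (e : keys edge) (ω : Ω) : f e (X e.1.1 e.1.2.1 e.1.2.2 ω) = fibre X edge e.1 ω := by
    refine Finset.prod_congr rfl fun p _ => ?_
    by_cases hp : (edge p).key = e.1
    · rw [if_pos hp, if_pos hp, h.ent_eq, hp]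
      rfl
    · rw [if_neg hp, if_neg hp]
  have h1 := ((h.iIndepFun_key n).precomp hg).integral_fun_prod_comp
    (fun e => ((h.wigner _).measurable _ _).aemeasurable)
    (fun e => (hf e).aestronglyMeasurable)
  simp only [g, hff] at h1
  rw [← Finset.prod_coe_sort (keys edge) (fun e => ∫ ω, fibre X edge e ω ∂P), ← h1]
  refine integral_congr_ae (Eventually.of_forall fun ω => ?_)
  simp only [monomial]
  rw [Finset.prod_coe_sort (keys edge) (fun e => fibre X edge e ω)]
  simp only [fibre]
  rw [Finset.prod_comm]
  refine Finset.prod_congr rfl fun p _ => ?_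
  rw [Finset.prod_ite_eq, if_pos (key_mem_keys edge p)]

lemma keys_sumElim (f : ι → Edge m n) (g : ι' → Edge m n) :
    keys (Sum.elim f g) = keys f ∪ keys g := by
  ext e
  simp [mem_keys]

lemma monomial_sumElim (f : ι → Edge m n) (g : ι' → Edge m n) (ω : Ω) :
    monomial X (Sum.elim f g) ω = monomial X f ω * monomial X g ω := by
  simp [monomial, Fintype.prod_sum_type]

lemma fibre_sumElim (f : ι → Edge m n) (g : ι' → Edge m n) (e : Edge m n) (ω : Ω) :
    fibre X (Sum.elim f g) e ω = fibre X f e ω * fibre X g e ω := by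
  rw [fibre, Fintype.prod_sum_type]
  rfl

lemma fibre_of_notMem {f : ι → Edge m n} {e : Edge m n} (h : e ∉ keys f) (ω : Ω) :
    fibre X f e ω = 1 := by
  refine Finset.prod_eq_one fun p _ => if_neg fun hp => h ?_
  exact mem_keys.2 ⟨p, hp⟩

lemma IsWignerFamily.integral_monomial_mul (h : IsWignerFamily P X) (f : ι → Edge m n)
    (g : ι' → Edge m n) (hd : Disjoint (keys f) (keys g)) :
    ∫ ω, monomial X f ω * monomial X g ω ∂P =
      (∫ ω, monomial X f ω ∂P) * ∫ ω, monomial X g ω ∂P := by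
  have h1 := h.integral_monomial (Sum.elim f g)
  simp only [monomial_sumElim] at h1
  rw [h1, keys_sumElim, Finset.prod_union hd, h.integral_monomial f, h.integral_monomial g]
  congr 1
  · refine Finset.prod_congr rfl fun e he => ?_
    simp only [fibre_sumElim, fibre_of_notMem (Finset.disjoint_left.1 hd he), mul_one]
  · refine Finset.prod_congr rfl fun e he => ?_
    simp only [fibre_sumElim, fibre_of_notMem (Finset.disjoint_right.1 hd he), one_mul]

end

/-! ### Bounds for the expectations of monomials -/

section

variable {Ω : Type*} [MeasurableSpace Ω] {P : Measure Ω} [IsProbabilityMeasure P]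
variable {m n : ℕ} {X : Fin m → ℕ → ℕ → Ω → ℂ}
variable {ι ι' : Type*} [Fintype ι] [Fintype ι']

/-- The number of edges over a given undirected edge. -/
def mult (edge : ι → Edge m n) (e : Edge m n) : ℕ :=
  (Finset.univ.filter fun p => (edge p).key = e).card

/-- The weight of an undirected edge: an edge of weight `w` contributes a factor `O(n ^ (-w / 2))` to
the expectation of a monomial. -/
def weight (edge : ι → Edge m n) (e : Edge m n) : ℕ :=
  if e.2.1 = e.2.2 then 1 else if mult edge e = 2 then 2 else 3

/-- The total weight of a family of edges. -/
def cost (edge : ι → Edge m n) : ℕ := ∑ e ∈ keys edge, weight edge e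

lemma fibre_eq_prod_filter (edge : ι → Edge m n) (e : Edge m n) (ω : Ω) :
    fibre X edge e ω = ∏ p with (edge p).key = e, ent X (edge p) ω := by
  rw [fibre, Finset.prod_filter]

lemma IsWignerFamily.norm_fibre (h : IsWignerFamily P X) (edge : ι → Edge m n) (e : Edge m n)
    (ω : Ω) : ‖fibre X edge e ω‖ = ‖ent X e ω‖ ^ mult edge e := by
  rw [fibre_eq_prod_filter, norm_prod, mult, ← Finset.prod_const]
  refine Finset.prod_congr rfl fun p hp => ?_
  rw [← h.norm_ent_key (edge p), (Finset.mem_filter.1 hp).2]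

lemma IsWignerFamily.integrable_pow (h : IsWignerFamily P X) (l : Fin m) {k : ℕ} (hk : k ≤ 4) :
    Integrable (fun ω => ‖X l 0 1 ω‖ ^ k) P :=
  (MemLp.mono_exponent (h.memLp_off l)
    (by exact_mod_cast hk : ((k : ℕ) : ENNReal) ≤ 4)).integrable_norm_pow'

lemma IsWignerFamily.integrable_pow_diag (h : IsWignerFamily P X) (l : Fin m) {k : ℕ} (hk : k ≤ 2) :
    Integrable (fun ω => ‖X l 0 0 ω‖ ^ k) P :=
  (MemLp.mono_exponent (h.memLp_diag l)
    (by exact_mod_cast hk : ((k : ℕ) : ENNReal) ≤ 2)).integrable_norm_pow'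

/-- A common bound for the moments of the entries. -/
def momentBound (P : Measure Ω) (X : Fin m → ℕ → ℕ → Ω → ℂ) : ℝ :=
  1 + ∑ l, (∫ ω, ‖X l 0 1 ω‖ ^ 3 ∂P + ∫ ω, ‖X l 0 0 ω‖ ∂P)

lemma moment_le (l : Fin m) :
    1 + (∫ ω, ‖X l 0 1 ω‖ ^ 3 ∂P + ∫ ω, ‖X l 0 0 ω‖ ∂P) ≤ momentBound P X := by
  have := Finset.single_le_sum
    (f := fun l => ∫ ω, ‖X l 0 1 ω‖ ^ 3 ∂P + ∫ ω, ‖X l 0 0 ω‖ ∂P)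
    (fun l _ => by positivity) (Finset.mem_univ l)
  unfold momentBound
  linarith

lemma one_le_momentBound : 1 ≤ momentBound P X := by
  have : 0 ≤ ∑ l, (∫ ω, ‖X l 0 1 ω‖ ^ 3 ∂P + ∫ ω, ‖X l 0 0 ω‖ ∂P) :=
    Finset.sum_nonneg fun l _ => by positivity
  unfold momentBound
  linarith

lemma moment_three_le (l : Fin m) : ∫ ω, ‖X l 0 1 ω‖ ^ 3 ∂P ≤ momentBound P X := by
  have := moment_le (P := P) (X := X) l
  have : 0 ≤ ∫ ω, ‖X l 0 0 ω‖ ∂P := by positivity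
  linarith

lemma moment_diag_le (l : Fin m) : ∫ ω, ‖X l 0 0 ω‖ ∂P ≤ momentBound P X := by
  have := moment_le (P := P) (X := X) l
  have : 0 ≤ ∫ ω, ‖X l 0 1 ω‖ ^ 3 ∂P := by positivity
  linarith

lemma IsWignerFamily.integral_upper_eq (h : IsWignerFamily P X) {E : Type*} [NormedAddCommGroup E]
    [NormedSpace ℝ E] [MeasurableSpace E] [BorelSpace E]
    (l : Fin m) {i j : ℕ} (hij : i < j) {g : ℂ → E} (hg : Measurable g) :
    ∫ ω, g (X l i j ω) ∂P = ∫ ω, g (X l 0 1 ω) ∂P :=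
  (((h.wigner l).ident_upper i j hij).comp hg).integral_eq

lemma IsWignerFamily.integral_diag_eq (h : IsWignerFamily P X) {E : Type*} [NormedAddCommGroup E]
    [NormedSpace ℝ E] [MeasurableSpace E] [BorelSpace E]
    (l : Fin m) (i : ℕ) {g : ℂ → E} (hg : Measurable g) :
    ∫ ω, g (X l i i ω) ∂P = ∫ ω, g (X l 0 0 ω) ∂P :=
  (((h.wigner l).ident_diag i).comp hg).integral_eq

/-- Where the truncation acts, `‖z‖ > s`, hence `‖z‖ ≤ ‖z‖ ^ 3 / s ^ 2`. -/
lemma norm_sub_trunc_le {s : ℝ} (hs : 0 < s) (z : ℂ) : ‖trunc s z - z‖ ≤ (1 / s) ^ 2 * ‖z‖ ^ 3 := by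
  unfold trunc
  split_ifs with h
  · simp; positivity
  · push Not at h
    rw [zero_sub, norm_neg, div_pow, one_pow, div_mul_eq_mul_div, one_mul,
      le_div_iff₀ (by positivity)]
    have h1 : s ^ 2 ≤ ‖z‖ ^ 2 := pow_le_pow_left₀ hs.le h.le 2
    nlinarith [norm_nonneg z]

lemma integrable_trunc {Y : Ω → ℂ} (hY : Measurable Y) (s : ℝ) (hs : 0 ≤ s) :
    Integrable (fun ω => trunc s (Y ω)) P :=
  Integrable.of_bound ((measurable_trunc s).comp hY).aestronglyMeasurable s
    (Eventually.of_forall fun _ => norm_trunc_le s hs _)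

/-- Truncation destroys centring only slightly: with `s = √n` the mean is `O(1 / n)`. After
normalization an edge used once contributes `O(n ^ (-3/2))`, as good as an edge used three times. -/
lemma IsWignerFamily.norm_integral_trunc_le (h : IsWignerFamily P X) (l : Fin m) {s : ℝ}
    (hs : 0 < s) : ‖∫ ω, trunc s (X l 0 1 ω) ∂P‖ ≤ (1 / s) ^ 2 * momentBound P X := by
  have hint : Integrable (X l 0 1) P := (h.memLp_off l).integrable (by norm_num)
  have h1 : ∫ ω, trunc s (X l 0 1 ω) ∂P = ∫ ω, (trunc s (X l 0 1 ω) - X l 0 1 ω) ∂P := by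
    rw [integral_sub (integrable_trunc ((h.wigner l).measurable _ _) s hs.le) hint,
      (h.wigner l).mean_upper, sub_zero]
  rw [h1]
  calc ‖∫ ω, (trunc s (X l 0 1 ω) - X l 0 1 ω) ∂P‖
      ≤ ∫ ω, (1 / s) ^ 2 * ‖X l 0 1 ω‖ ^ 3 ∂P :=
        norm_integral_le_of_norm_le ((h.integrable_pow l (by norm_num)).const_mul _)
          (Eventually.of_forall fun ω => norm_sub_trunc_le hs _)
    _ ≤ _ := by
        rw [integral_const_mul]
        exact mul_le_mul_of_nonneg_left (moment_three_le l) (by positivity)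

lemma IsWignerFamily.norm_integral_fibre_le (h : IsWignerFamily P X) (hn : 0 < n)
    (edge : ι → Edge m n) (e : Edge m n) (he : e ∈ keys edge) :
    ‖∫ ω, fibre X edge e ω ∂P‖ ≤ momentBound P X * (1 / √n) ^ weight edge e := by
  obtain ⟨p₀, hp₀⟩ := mem_keys.1 he
  have hM := one_le_momentBound (P := P) (X := X)
  have hs : 0 < √(n : ℝ) := by positivity
  have hle : e.2.1 ≤ e.2.2 := hp₀ ▸ Edge.key_le _
  have hmult : 0 < mult edge e := Finset.card_pos.2 ⟨p₀, by simpa using hp₀⟩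
  obtain ⟨l, i, j⟩ := e
  simp only at hle
  have hmeas : Measurable (X l i j) := (h.wigner l).measurable _ _
  -- Of the factors in the fibre, `k` are estimated by the untruncated entry and the others by one.
  have hbound (k : ℕ) (hk : k ≤ mult edge (l, i, j)) (ω : Ω) :
      ‖fibre X edge (l, i, j) ω‖ ≤ (1 / √n) ^ k * ‖X l i j ω‖ ^ k := by
    rw [h.norm_fibre, ← mul_pow]
    exact (pow_le_pow_of_le_one (norm_nonneg _) (norm_ent_le_one _ _) hk).trans
      (pow_le_pow_left₀ (norm_nonneg _) (norm_ent_le _ _) k)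
  by_cases hij : i = j
  · subst hij
    rw [weight, if_pos rfl]
    have hI := h.integrable_pow_diag l (k := 1) (by norm_num)
    have hid : ∫ ω, ‖X l i i ω‖ ∂P = ∫ ω, ‖X l 0 0 ω‖ ∂P := h.integral_diag_eq l i measurable_norm
    have hI' : Integrable (fun ω => ‖X l i i ω‖) P :=
      (((h.wigner l).ident_diag i).norm.integrable_iff).2 (by simpa using hI)
    calc _ ≤ ∫ ω, (1 / √n) ^ 1 * ‖X l i i ω‖ ∂P :=
          norm_integral_le_of_norm_le (hI'.const_mul _)
            (Eventually.of_forall fun ω => by simpa using hbound 1 hmult ω)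
      _ ≤ _ := by
          rw [integral_const_mul, hid, mul_comm]
          exact mul_le_mul_of_nonneg_right (moment_diag_le l) (by positivity)
  · have hlt : (i : ℕ) < j := lt_of_le_of_ne hle (fun hh => hij (Fin.ext hh))
    rw [weight, if_neg hij]
    have hupper (k : ℕ) (hk : k ≤ mult edge (l, i, j)) (hk4 : k ≤ 4) :
        ‖∫ ω, fibre X edge (l, i, j) ω ∂P‖ ≤ (1 / √n) ^ k * ∫ ω, ‖X l 0 1 ω‖ ^ k ∂P := by
      have hg : Measurable fun z : ℂ => ‖z‖ ^ k := by fun_prop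
      have hid := h.integral_upper_eq l hlt hg
      have hI' : Integrable (fun ω => ‖X l i j ω‖ ^ k) P :=
        ((((h.wigner l).ident_upper i j hlt).comp hg).integrable_iff).2 (h.integrable_pow l hk4)
      calc _ ≤ ∫ ω, (1 / √n) ^ k * ‖X l i j ω‖ ^ k ∂P :=
            norm_integral_le_of_norm_le (hI'.const_mul _) (Eventually.of_forall (hbound k hk))
        _ = _ := by rw [integral_const_mul, hid]
    split_ifs with h2
    · have := hupper 2 h2.ge (by norm_num)
      rw [(h.wigner l).variance_upper, mul_one] at this
      exact this.trans (le_mul_of_one_le_left (by positivity) hM)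
    -- Multiplicity one uses the small truncated mean; multiplicity at least three uses the third
    -- absolute moment.
    · by_cases h1 : mult edge (l, i, j) = 1
      · obtain ⟨p, hp⟩ := Finset.card_eq_one.1 h1
        have hkey : (edge p).key = (l, i, j) := by
          have : p ∈ Finset.univ.filter fun p => (edge p).key = (l, i, j) := by rw [hp]; simp
          simpa using this
        have hf (ω : Ω) : fibre X edge (l, i, j) ω = ent X (edge p) ω := by
          rw [fibre_eq_prod_filter, hp, Finset.prod_singleton]
        have hnorm : ‖∫ ω, fibre X edge (l, i, j) ω ∂P‖ = ‖∫ ω, ent X (l, i, j) ω ∂P‖ := by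
          simp only [hf]
          by_cases hpp : (edge p).2.1 ≤ (edge p).2.2
          · rw [← hkey, Edge.key_of_le hpp]
          · have : ∀ ω, ent X (edge p) ω = (starRingEnd ℂ) (ent X (l, i, j) ω) := fun ω => by
              rw [h.ent_eq, if_neg hpp, hkey]
              rfl
            simp only [this]
            rw [integral_conj, RCLike.norm_conj]
        rw [hnorm]
        simp only [ent]
        rw [integral_const_mul, h.integral_upper_eq l hlt (measurable_trunc _), norm_mul,
          Complex.norm_real, Real.norm_of_nonneg (by positivity)]
        calc _ ≤ 1 / √n * ((1 / √n) ^ 2 * momentBound P X) :=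
              mul_le_mul_of_nonneg_left (h.norm_integral_trunc_le l hs) (by positivity)
          _ = _ := by ring
      · refine (hupper 3 (by omega) (by norm_num)).trans ?_
        rw [mul_comm]
        exact mul_le_mul_of_nonneg_right (moment_three_le l) (by positivity)

lemma IsWignerFamily.norm_integral_monomial_le (h : IsWignerFamily P X) (hn : 0 < n)
    (edge : ι → Edge m n) :
    ‖∫ ω, monomial X edge ω ∂P‖ ≤
      momentBound P X ^ Fintype.card ι * (1 / √n) ^ cost edge := by
  have hM := one_le_momentBound (P := P) (X := X)
  rw [h.integral_monomial, norm_prod]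
  calc _ ≤ ∏ e ∈ keys edge, momentBound P X * (1 / √n) ^ weight edge e :=
        Finset.prod_le_prod (fun _ _ => norm_nonneg _) fun e he => h.norm_integral_fibre_le hn edge e he
    _ = momentBound P X ^ (keys edge).card * (1 / √n) ^ cost edge := by
        rw [Finset.prod_mul_distrib, Finset.prod_const, Finset.prod_pow_eq_pow_sum, cost]
    _ ≤ _ := by
        -- There are at most as many undirected edges as factors, and the moment bound is at least
        -- one.
        refine mul_le_mul_of_nonneg_right (pow_le_pow_right₀ hM ?_) (by positivity)
        exact Finset.card_image_le

/-- The second absolute moment of the truncated entries. -/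
def truncVar (P : Measure Ω) (X : Fin m → ℕ → ℕ → Ω → ℂ) (l : Fin m) (n : ℕ) : ℝ :=
  ∫ ω, ‖trunc √n (X l 0 1 ω)‖ ^ 2 ∂P

lemma IsWignerFamily.tendsto_truncVar (h : IsWignerFamily P X) (l : Fin m) :
    Tendsto (truncVar P X l) atTop (𝓝 1) := by
  rw [← (h.wigner l).variance_upper]
  refine tendsto_integral_of_dominated_convergence (fun ω => ‖X l 0 1 ω‖ ^ 2) (fun n => ?_)
    (h.integrable_pow l (by norm_num)) (fun n => Eventually.of_forall fun ω => ?_)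
    (Eventually.of_forall fun ω => ?_)
  · exact (((measurable_trunc _).comp ((h.wigner l).measurable _ _)).norm.pow_const 2).aestronglyMeasurable
  · rw [Real.norm_of_nonneg (by positivity)]
    exact pow_le_pow_left₀ (norm_nonneg _) (norm_trunc_le_norm _ _) 2
  · refine tendsto_const_nhds.congr' ?_
    filter_upwards [(tendsto_natCast_atTop_atTop (R := ℝ)).eventually_ge_atTop (‖X l 0 1 ω‖ ^ 2)]
      with n hn
    rw [trunc, if_pos (Real.le_sqrt_of_sq_le hn)]

lemma IsWignerFamily.integral_ent_mul_ent (h : IsWignerFamily P X) (l : Fin m) {i j : Fin n}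
    (hij : i ≠ j) :
    ∫ ω, ent X (l, i, j) ω * ent X (l, j, i) ω ∂P = ((1 / n * truncVar P X l n : ℝ) : ℂ) := by
  have hmeas : Measurable fun z : ℂ => ‖trunc √n z‖ ^ 2 := (measurable_trunc _).norm.pow_const 2
  have key : ∀ i j : Fin n, i < j →
      ∫ ω, ent X (l, i, j) ω * ent X (l, j, i) ω ∂P = ((1 / n * truncVar P X l n : ℝ) : ℂ) := by
    intro i j hij
    rw [truncVar, ← h.integral_upper_eq l (show (i : ℕ) < j from hij) hmeas, ← integral_const_mul,
      ← integral_complex_ofReal]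
    refine integral_congr_ae (Eventually.of_forall fun ω => ?_)
    simp only
    rw [← h.star_ent l i j, ← starRingEnd_apply, Complex.mul_conj, Complex.normSq_eq_norm_sq,
      norm_ent, mul_pow, div_pow, Real.sq_sqrt (by positivity), one_pow]
  rcases lt_or_gt_of_ne hij with hlt | hlt
  · exact key i j hlt
  · rw [← key j i hlt]
    simp only [mul_comm]

end

/-! ### Counting vertices against edges -/

/-- If the functions on a vertex set are determined by their increments along the edges in `T` and
their values at `R`, then there are at most `|T| + |R|` vertices. -/
lemma card_le_card_add_card {N E : Type*} [Fintype N] [DecidableEq N] (S R : Finset N)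
    (T : Finset E) (a b : E → N)
    (h : ∀ f : N → ℚ, (∀ e ∈ T, f (a e) = f (b e)) → (∀ x ∈ R, f x = 0) → ∀ x ∈ S, f x = 0) :
    S.card ≤ T.card + R.card := by
  -- Functions on `S`, extended by zero, are sent to their increments along `T` and their values on
  -- `R`. The hypothesis says that this linear map is injective, and the bound compares dimensions.
  let ext : (S → ℚ) →ₗ[ℚ] (N → ℚ) :=
    { toFun := fun g x => if hx : x ∈ S then g ⟨x, hx⟩ else 0
      map_add' := fun f g => by ext x; by_cases hx : x ∈ S <;> simp [hx]
      map_smul' := fun c f => by ext x; by_cases hx : x ∈ S <;> simp [hx] }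
  let Φ : (N → ℚ) →ₗ[ℚ] (T → ℚ) × (R → ℚ) :=
    { toFun := fun f => (fun e => f (b e.1) - f (a e.1), fun x => f x.1)
      map_add' := fun f g => by
        refine Prod.ext (funext fun e => ?_) (funext fun x => ?_) <;> simp; ring
      map_smul' := fun c f => by
        refine Prod.ext (funext fun e => ?_) (funext fun x => ?_) <;> simp; ring }
  have hinj : Function.Injective (Φ ∘ₗ ext) := by
    rw [injective_iff_map_eq_zero]
    intro g hg
    have h1 := congrArg Prod.fst hg
    have h2 := congrArg Prod.snd hg
    have h3 := h (ext g) (fun e he => (sub_eq_zero.1 (congrFun h1 ⟨e, he⟩)).symm)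
      (fun x hx => congrFun h2 ⟨x, hx⟩)
    ext x
    have h4 := h3 x.1 x.2
    change (if hx : x.1 ∈ S then g ⟨x.1, hx⟩ else 0) = 0 at h4
    simpa using h4
  have := LinearMap.finrank_le_finrank_of_injective hinj
  simpa using this

section

variable {m n : ℕ} {ι : Type*} [Fintype ι]

/-- A function that is constant along the edges and vanishes on `R` vanishes on `S`. -/
def Connects (edge : ι → Edge m n) (R S : Finset (Fin n)) : Prop :=
  ∀ f : Fin n → ℚ, (∀ p, f (edge p).2.1 = f (edge p).2.2) → (∀ x ∈ R, f x = 0) → ∀ x ∈ S, f x = 0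

/-- The orientation of a directed edge with respect to its underlying undirected edge. -/
def Edge.sign (e : Edge m n) : ℚ := if e.2.1 ≤ e.2.2 then 1 else -1

/-- The flow of `c` through an undirected edge. -/
def flow (edge : ι → Edge m n) (c : ι → ℚ) (e : Edge m n) : ℚ :=
  ∑ p, if (edge p).key = e then c p * (edge p).sign else 0

/-- The edge family has a loop, an edge of multiplicity other than two, or supports a circulation
with a nonzero flow through some edge. -/
def Irregular (edge : ι → Edge m n) : Prop :=
  (∃ p, (edge p).2.1 = (edge p).2.2) ∨ (∃ p, mult edge (edge p).key ≠ 2) ∨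
    ∃ c : ι → ℚ, (∀ f : Fin n → ℚ, ∑ p, c p * (f (edge p).2.2 - f (edge p).2.1) = 0) ∧
      ∃ p, flow edge c (edge p).key ≠ 0

/-- The undirected edges that are not loops. -/
def links (edge : ι → Edge m n) : Finset (Edge m n) := (keys edge).filter fun e => e.2.1 ≠ e.2.2

lemma Edge.apply_key (f : Fin n → ℚ) (e : Edge m n) :
    f e.2.2 - f e.2.1 = e.sign * (f e.key.2.2 - f e.key.2.1) := by
  rcases le_total e.2.1 e.2.2 with h | h
  · rw [Edge.key_of_le h, Edge.sign, if_pos h, one_mul]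
  · rw [Edge.key_of_ge h, Edge.sign]
    split_ifs with h2
    · rw [le_antisymm h h2]; ring
    · ring

lemma Edge.key_loop_iff (e : Edge m n) : e.key.2.1 = e.key.2.2 ↔ e.2.1 = e.2.2 := by
  rcases le_total e.2.1 e.2.2 with h | h
  · rw [Edge.key_of_le h]
  · rw [Edge.key_of_ge h, eq_comm]

lemma apply_eq_of_links {edge : ι → Edge m n} {f : Fin n → ℚ}
    (h : ∀ e ∈ links edge, f e.2.1 = f e.2.2) (p : ι) : f (edge p).2.1 = f (edge p).2.2 := by
  by_cases hp : (edge p).2.1 = (edge p).2.2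
  · rw [hp]
  · have h1 := h (edge p).key (Finset.mem_filter.2 ⟨key_mem_keys edge p, fun h2 =>
      hp ((Edge.key_loop_iff _).1 h2)⟩)
    have h2 := Edge.apply_key f (edge p)
    rw [h1, sub_self, mul_zero, sub_eq_zero] at h2
    exact h2.symm

lemma weight_ge (edge : ι → Edge m n) (e : Edge m n) :
    (if e.2.1 ≠ e.2.2 then 2 else 0) ≤ weight edge e := by
  unfold weight
  split_ifs <;> simp_all

lemma sum_links (edge : ι → Edge m n) :
    ∑ e ∈ keys edge, (if e.2.1 ≠ e.2.2 then 2 else 0) = 2 * (links edge).card := by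
  rw [← Finset.sum_filter, Finset.sum_const, links, smul_eq_mul, mul_comm]

lemma two_mul_card_links_le (edge : ι → Edge m n) : 2 * (links edge).card ≤ cost edge := by
  rw [← sum_links, cost]
  exact Finset.sum_le_sum fun e _ => weight_ge edge e

lemma two_mul_card_links_lt (edge : ι → Edge m n) (p : ι)
    (hp : (edge p).2.1 = (edge p).2.2 ∨ mult edge (edge p).key ≠ 2) :
    2 * (links edge).card < cost edge := by
  rw [← sum_links, cost]
  refine Finset.sum_lt_sum (fun e _ => weight_ge edge e) ⟨_, key_mem_keys edge p, ?_⟩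
  unfold weight
  by_cases h : (edge p).2.1 = (edge p).2.2
  · have := (Edge.key_loop_iff (edge p)).2 h
    simp [this]
  · have h1 : ¬(edge p).key.2.1 = (edge p).key.2.2 := fun h2 => h ((Edge.key_loop_iff _).1 h2)
    simp [h1, hp.resolve_left h]

lemma Connects.card_le {edge : ι → Edge m n} {R S : Finset (Fin n)} (h : Connects edge R S) :
    S.card ≤ (links edge).card + R.card :=
  card_le_card_add_card S R (links edge) (fun e => e.2.1) (fun e => e.2.2)
    fun f hf hR => h f (apply_eq_of_links hf) hR

lemma Connects.two_mul_card_le {edge : ι → Edge m n} {R S : Finset (Fin n)}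
    (h : Connects edge R S) : 2 * S.card ≤ cost edge + 2 * R.card := by
  have := h.card_le
  have := two_mul_card_links_le edge
  omega

/-- A link carrying nonzero flow of a circulation lies on a cycle, so it can be deleted without
disconnecting anything; the count then improves by one. -/
lemma Connects.card_lt_of_flow {edge : ι → Edge m n} {R S : Finset (Fin n)}
    (h : Connects edge R S) (c : ι → ℚ)
    (hc : ∀ f : Fin n → ℚ, ∑ p, c p * (f (edge p).2.2 - f (edge p).2.1) = 0)
    (p : ι) (hloop : (edge p).2.1 ≠ (edge p).2.2) (hp : flow edge c (edge p).key ≠ 0) :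
    S.card + 1 ≤ (links edge).card + R.card := by
  have hmem : (edge p).key ∈ links edge := Finset.mem_filter.2 ⟨key_mem_keys edge p, fun h2 =>
      hloop ((Edge.key_loop_iff _).1 h2)⟩
  have h1 := card_le_card_add_card S R ((links edge).erase (edge p).key) (fun e => e.2.1)
    (fun e => e.2.2) fun f hf hR => h f (apply_eq_of_links fun e he => ?_) hR
  · rw [Finset.card_erase_of_mem hmem] at h1
    have := Finset.card_pos.2 ⟨_, hmem⟩
    omega
  by_cases hee : e = (edge p).key
  · have h2 : flow edge c e * (f e.2.2 - f e.2.1) = 0 := by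
      rw [← hc f, flow, Finset.sum_mul]
      refine Finset.sum_congr rfl fun q _ => ?_
      rw [Edge.apply_key f (edge q)]
      split_ifs with hq
      · rw [hq]; ring
      · by_cases hl : (edge q).key.2.1 = (edge q).key.2.2
        · rw [hl]; ring
        · have := hf (edge q).key (Finset.mem_erase.2 ⟨fun h3 => hq (h3.trans hee.symm),
            Finset.mem_filter.2 ⟨key_mem_keys edge q, hl⟩⟩)
          rw [this]; ring
    rw [← hee] at hp
    exact (sub_eq_zero.1 ((mul_eq_zero.1 h2).resolve_left hp)).symm
  · exact hf e (Finset.mem_erase.2 ⟨hee, he⟩)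

/-- A loop or a multiplicity other than two raises the cost above twice the number of links; a
circulation lowers the number of vertices instead. Either way half a power of `n` is saved. -/
lemma Connects.two_mul_card_lt {edge : ι → Edge m n} {R S : Finset (Fin n)}
    (h : Connects edge R S) (hirr : Irregular edge) :
    2 * S.card + 1 ≤ cost edge + 2 * R.card := by
  by_cases hlt : ∃ p, (edge p).2.1 = (edge p).2.2 ∨ mult edge (edge p).key ≠ 2
  · obtain ⟨p, hp⟩ := hlt
    have := h.card_le
    have := two_mul_card_links_lt edge p hp
    omega
  · push Not at hlt
    rcases hirr with ⟨p, hp⟩ | ⟨p, hp⟩ | ⟨c, hc, p, hp⟩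
    · exact absurd hp (hlt p).1
    · exact absurd (hlt p).2 hp
    · have := h.card_lt_of_flow c hc p (hlt p).1 hp
      have := two_mul_card_links_le edge
      omega

end

/-! ### Sums over vertex labellings -/

/-- There are `O(n ^ r)` labellings with `r` distinct values, each of weight `n ^ (-r)`, so the sum
is bounded uniformly in `n`. -/
lemma sum_inv_pow_card_image_le (V : Type*) [Fintype V] [DecidableEq V] (n : ℕ) :
    ∑ φ : V → Fin n, (1 / (n : ℝ)) ^ (Finset.univ.image φ).card ≤
      (Fintype.card V : ℝ) ^ Fintype.card V := by
  classical
  -- The coincidence pattern of `φ` is encoded by a map `c` choosing a representative in each level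
  -- set. Then `φ` is determined by its values on the image of `c`, and there are `|V| ^ |V|` maps
  -- `c`.
  let B : (V → V) → Finset (V → Fin n) := fun c => Finset.univ.filter fun φ =>
    φ ∘ c = φ ∧ (Finset.univ.image φ).card = (Finset.univ.image c).card
  have hcover (φ : V → Fin n) : ∃ c, φ ∈ B c := by
    rcases isEmpty_or_nonempty V with hV | hV
    · exact ⟨id, by simpa [B] using Subsingleton.elim _ _⟩
    · have hinv (v : V) : φ (Function.invFun φ (φ v)) = φ v := Function.invFun_eq ⟨v, rfl⟩
      refine ⟨fun v => Function.invFun φ (φ v), ?_⟩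
      simp only [B, Finset.mem_filter, Finset.mem_univ, true_and]
      refine ⟨funext hinv, ?_⟩
      have : (Finset.univ.image fun v => Function.invFun φ (φ v)) =
          (Finset.univ.image φ).image (Function.invFun φ) := by
        rw [Finset.image_image]; rfl
      rw [this]
      refine (Finset.card_image_of_injOn ?_).symm
      intro x hx y hy hxy
      simp only [Finset.coe_image, Finset.coe_univ, Set.image_univ, Set.mem_range] at hx hy
      obtain ⟨u, rfl⟩ := hx
      obtain ⟨v, rfl⟩ := hy
      rw [← hinv u, ← hinv v, hxy]
  have hcard (c : V → V) : (B c).card ≤ n ^ (Finset.univ.image c).card := by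
    have : (B c).card ≤ (Finset.univ : Finset ((Finset.univ.image c) → Fin n)).card := by
      refine Finset.card_le_card_of_injOn (fun φ v => φ v.1) (fun _ _ => Finset.mem_univ _) ?_
      intro φ hφ ψ hψ hφψ
      simp only [B, Finset.coe_filter, Finset.mem_univ, true_and] at hφ hψ
      rw [← hφ.1, ← hψ.1]
      ext v
      have := congrFun hφψ ⟨c v, Finset.mem_image_of_mem _ (Finset.mem_univ v)⟩
      simp only at this
      simp [this]
    rwa [Finset.card_univ, Fintype.card_fun, Fintype.card_fin, Fintype.card_coe] at this
  calc ∑ φ : V → Fin n, (1 / (n : ℝ)) ^ (Finset.univ.image φ).card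
      ≤ ∑ φ : V → Fin n, ∑ c : V → V,
          if φ ∈ B c then (1 / (n : ℝ)) ^ (Finset.univ.image c).card else 0 := by
        refine Finset.sum_le_sum fun φ _ => ?_
        obtain ⟨c, hc⟩ := hcover φ
        have h1 := Finset.single_le_sum (f := fun c : V → V =>
          if φ ∈ B c then (1 / (n : ℝ)) ^ (Finset.univ.image c).card else 0)
          (fun c _ => by split_ifs <;> positivity) (Finset.mem_univ c)
        simp only [hc, if_true] at h1
        rwa [(Finset.mem_filter.1 hc).2.2]
    _ = ∑ c : V → V, ((B c).card : ℝ) * (1 / (n : ℝ)) ^ (Finset.univ.image c).card := by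
        rw [Finset.sum_comm]
        refine Finset.sum_congr rfl fun c _ => ?_
        rw [← Finset.sum_filter, Finset.sum_const, nsmul_eq_mul]
        congr 3
        ext φ
        simp
    _ ≤ ∑ c : V → V, (1 : ℝ) := by
        refine Finset.sum_le_sum fun c _ => ?_
        calc ((B c).card : ℝ) * (1 / (n : ℝ)) ^ (Finset.univ.image c).card
            ≤ (n : ℝ) ^ (Finset.univ.image c).card * (1 / (n : ℝ)) ^ (Finset.univ.image c).card :=
              mul_le_mul_of_nonneg_right (by exact_mod_cast hcard c) (by positivity)
          _ ≤ 1 := by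
              rw [← mul_pow]
              refine pow_le_one₀ (by positivity) ?_
              rw [mul_one_div]
              exact div_self_le_one _
    _ = _ := by simp

section

variable {Ω : Type*} [MeasurableSpace Ω] {P : Measure Ω} [IsProbabilityMeasure P]
variable {m n : ℕ} {X : Fin m → ℕ → ℕ → Ω → ℂ}

/-- Power counting: `c` half powers come from the normalization, `a φ` from the expectation, and
each distinct value of `φ` uses up two. The surplus `d` is the decay obtained. -/
lemma sum_le_of_card_image_le (hn : 0 < n) {V : Type*} [Fintype V] [DecidableEq V]
    (F : (V → Fin n) → ℝ) (K : ℝ) (hK : 0 ≤ K) (Φ : Finset (V → Fin n)) (c d : ℕ)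
    (a : (V → Fin n) → ℕ) (hF : ∀ φ ∈ Φ, F φ ≤ K * (1 / √n) ^ a φ)
    (hcost : ∀ φ ∈ Φ, 2 * (Finset.univ.image φ).card + d ≤ a φ + c) :
    (1 / √n) ^ c * ∑ φ ∈ Φ, F φ ≤
      K * (Fintype.card V : ℝ) ^ Fintype.card V * (1 / √n) ^ d := by
  have hn1 : (1 : ℝ) ≤ n := by exact_mod_cast hn
  have hr1 : 1 / √(n : ℝ) ≤ 1 := by
    rw [div_le_one (by positivity)]
    exact Real.one_le_sqrt.2 hn1
  have hr2 : (1 / √(n : ℝ)) ^ 2 = 1 / n := by rw [div_pow, Real.sq_sqrt (by positivity), one_pow]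
  calc (1 / √n) ^ c * ∑ φ ∈ Φ, F φ
      ≤ ∑ φ ∈ Φ, K * (1 / √n) ^ d * (1 / (n : ℝ)) ^ (Finset.univ.image φ).card := by
        rw [Finset.mul_sum]
        refine Finset.sum_le_sum fun φ hφ => ?_
        calc (1 / √n) ^ c * F φ ≤ (1 / √n) ^ c * (K * (1 / √n) ^ a φ) :=
              mul_le_mul_of_nonneg_left (hF φ hφ) (by positivity)
          _ = K * (1 / √n) ^ (a φ + c) := by rw [pow_add]; ring
          _ ≤ K * (1 / √n) ^ (2 * (Finset.univ.image φ).card + d) :=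
              mul_le_mul_of_nonneg_left
                (pow_le_pow_of_le_one (by positivity) hr1 (hcost φ hφ)) hK
          _ = _ := by rw [pow_add, pow_mul, hr2]; ring
    _ ≤ K * (1 / √n) ^ d * ∑ φ : V → Fin n, (1 / (n : ℝ)) ^ (Finset.univ.image φ).card := by
        rw [← Finset.mul_sum]
        refine mul_le_mul_of_nonneg_left ?_ (by positivity)
        exact Finset.sum_le_sum_of_subset_of_nonneg (Finset.subset_univ _)
          fun _ _ _ => by positivity
    _ ≤ K * (1 / √n) ^ d * (Fintype.card V : ℝ) ^ Fintype.card V :=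
        mul_le_mul_of_nonneg_left (sum_inv_pow_card_image_le V n) (by positivity)
    _ = _ := by ring

lemma IsWignerFamily.sum_norm_integral_le (h : IsWignerFamily P X) (hn : 0 < n)
    {V ι : Type*} [Fintype V] [DecidableEq V] [Fintype ι] (edge : (V → Fin n) → ι → Edge m n)
    (Φ : Finset (V → Fin n)) (c d : ℕ)
    (hcost : ∀ φ ∈ Φ, 2 * (Finset.univ.image φ).card + d ≤ cost (edge φ) + c) :
    (1 / √n) ^ c * ∑ φ ∈ Φ, ‖∫ ω, monomial X (edge φ) ω ∂P‖ ≤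
      momentBound P X ^ Fintype.card ι * (Fintype.card V : ℝ) ^ Fintype.card V * (1 / √n) ^ d :=
  sum_le_of_card_image_le hn _ _ (pow_nonneg (zero_le_one.trans one_le_momentBound) _) Φ c d
    (fun φ => cost (edge φ)) (fun φ _ => h.norm_integral_monomial_le hn (edge φ)) hcost

end

/-! ### Traces as sums over closed walks -/

section

variable {n : ℕ}

/-- The closed walks of length `k` on `Fin n`. -/
def closedWalks (k n : ℕ) : Finset (Fin (k + 1) → Fin n) :=
  Finset.univ.filter fun φ => φ 0 = φ (Fin.last k)

lemma mem_closedWalks {k : ℕ} {φ : Fin (k + 1) → Fin n} :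
    φ ∈ closedWalks k n ↔ φ 0 = φ (Fin.last k) := by simp [closedWalks]

lemma prod_ofFn_apply {k : ℕ} (N : Fin k → Matrix (Fin n) (Fin n) ℂ) (i j : Fin n) :
    (List.ofFn N).prod i j = ∑ φ : Fin (k + 1) → Fin n,
      if φ 0 = i ∧ φ (Fin.last k) = j then ∏ p, N p (φ p.castSucc) (φ p.succ) else 0 := by
  induction k generalizing i with
  | zero =>
    rw [List.ofFn_zero, List.prod_nil, Matrix.one_apply,
      ← (Equiv.funUnique (Fin 1) (Fin n)).symm.sum_comp]
    have (x : Fin n) : (if x = i ∧ x = j then (1 : ℂ) else 0) =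
        if x = i then (if i = j then 1 else 0) else 0 := by
      by_cases hx : x = i
      · subst hx; simp
      · simp [hx]
    simp [this]
  | succ k ih =>
    rw [List.ofFn_succ, List.prod_cons, Matrix.mul_apply,
      ← (Fin.consEquiv (fun _ : Fin (k + 2) => Fin n)).sum_comp, Fintype.sum_prod_type]
    simp only [Fin.consEquiv_apply, Fin.prod_univ_succ, Fin.cons_zero, Fin.castSucc_zero,
      Fin.cons_succ, ← Fin.succ_last, ← Fin.succ_castSucc]
    conv_rhs => rw [Finset.sum_eq_single i (fun x _ hx => by simp [hx]) (by simp)]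
    simp only [ih, Finset.mul_sum]
    rw [Finset.sum_comm]
    refine Finset.sum_congr rfl fun φ _ => ?_
    rw [Finset.sum_eq_single (φ 0) (fun x _ hx => by simp [hx.symm]) (by simp)]
    by_cases hj : φ (Fin.last k) = j <;> simp [hj]

lemma trace_prod_ofFn {k : ℕ} (N : Fin k → Matrix (Fin n) (Fin n) ℂ) :
    (List.ofFn N).prod.trace =
      ∑ φ ∈ closedWalks k n, ∏ p, N p (φ p.castSucc) (φ p.succ) := by
  simp only [Matrix.trace, Matrix.diag_apply, prod_ofFn_apply]
  rw [Finset.sum_comm, closedWalks, Finset.sum_filter]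
  refine Finset.sum_congr rfl fun φ _ => ?_
  rw [Finset.sum_eq_single (φ 0) (fun x _ hx => by simp [hx.symm]) (by simp)]
  simp [eq_comm]

lemma trace_single_mul_mul_single_mul (i j : Fin n) (a b : ℂ)
    (M N : Matrix (Fin n) (Fin n) ℂ) :
    (Matrix.single i j a * (M * (Matrix.single j i b * N))).trace = a * b * M j j * N i i := by
  have h1 (Q : Matrix (Fin n) (Fin n) ℂ) (c : ℂ) (i j : Fin n) (x y : Fin n) :
      (Matrix.single i j c * Q) x y = if x = i then c * Q j y else 0 := by
    split_ifs with h
    · subst h; simp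
    · simp [h]
  simp only [Matrix.trace, Matrix.diag_apply, h1]
  rw [Finset.sum_eq_single i (fun x _ hx => by simp [hx]) (by simp), if_pos rfl, Matrix.mul_apply,
    Finset.sum_eq_single j (fun x _ hx => by simp [h1, hx]) (by simp), h1, if_pos rfl]
  ring

variable {Ω : Type*} [MeasurableSpace Ω] {P : Measure Ω} [IsProbabilityMeasure P]
variable {m : ℕ} {X : Fin m → ℕ → ℕ → Ω → ℂ}

/-- The truncated Wigner matrices. -/
def entMat (X : Fin m → ℕ → ℕ → Ω → ℂ) (n : ℕ) (ω : Ω) (l : Fin m) : Matrix (Fin n) (Fin n) ℂ :=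
  Matrix.of fun i j => ent X (l, i, j) ω

/-- The product of truncated Wigner matrices along a word. -/
def wordMat (X : Fin m → ℕ → ℕ → Ω → ℂ) (n : ℕ) (w : List (Fin m)) (ω : Ω) :
    Matrix (Fin n) (Fin n) ℂ := (w.map (entMat X n ω)).prod

/-- The labelled edges of a walk. -/
def walkEdge (w : List (Fin m)) (φ : Fin (w.length + 1) → Fin n) (p : Fin w.length) : Edge m n :=
  (w[p], φ p.castSucc, φ p.succ)

lemma wordMat_eq (w : List (Fin m)) (ω : Ω) :
    wordMat X n w ω = (List.ofFn fun p : Fin w.length => entMat X n ω w[p]).prod := by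
  rw [wordMat]
  congr 1
  refine List.ext_getElem (by simp) fun i h1 h2 => by simp

lemma trace_wordMat (w : List (Fin m)) (ω : Ω) :
    (wordMat X n w ω).trace = ∑ φ ∈ closedWalks w.length n, monomial X (walkEdge w φ) ω := by
  rw [wordMat_eq, trace_prod_ofFn]
  rfl

lemma wordMat_diag (w : List (Fin m)) (ω : Ω) (i : Fin n) :
    wordMat X n w ω i i =
      ∑ φ ∈ closedWalks w.length n, if φ 0 = i then monomial X (walkEdge w φ) ω else 0 := by
  rw [wordMat_eq, prod_ofFn_apply, closedWalks, Finset.sum_filter]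
  refine Finset.sum_congr rfl fun φ _ => ?_
  by_cases h1 : φ 0 = i
  · subst h1
    simp only [true_and, if_true, eq_comm]
    rfl
  · simp [h1]

/-! ### Cutting a walk where it reverses its first step -/

/-- The step `q + 1` of the walk reverses its first step. -/
def Returns (l : Fin m) (u : List (Fin m)) (q : Fin u.length)
    (φ : Fin ((l :: u).length + 1) → Fin n) : Prop :=
  u[q] = l ∧ φ (Fin.castSucc (n := u.length + 1) q.succ) = φ 1 ∧
    φ (Fin.succ (n := u.length + 1) q.succ) = φ 0

instance (l : Fin m) (u : List (Fin m)) (q : Fin u.length)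
    (φ : Fin ((l :: u).length + 1) → Fin n) : Decidable (Returns l u q φ) := by
  unfold Returns; infer_instance

lemma sum_returns (l : Fin m) (u : List (Fin m)) (q : Fin u.length) (hq : u[q] = l) (ω : Ω) :
    ∑ φ ∈ closedWalks (l :: u).length n,
      (if Returns l u q φ then monomial X (walkEdge (l :: u) φ) ω else 0) =
    ∑ φ ∈ closedWalks (u.take q).length n, ∑ ψ ∈ closedWalks (u.drop (q + 1)).length n,
      ent X (l, ψ 0, φ 0) ω * ent X (l, φ 0, ψ 0) ω *
        (monomial X (walkEdge (u.take q) φ) ω * monomial X (walkEdge (u.drop (q + 1)) ψ) ω) := by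
  let A := entMat X n ω
  -- Replacing the first factor and its partner by multiples of matrix units forces the first step
  -- to be `i → j` and the later one `j → i`. The trace then splits into diagonal entries of the two
  -- remaining words, at `j` and at `i`.
  let N : Fin n → Fin n → Fin (l :: u).length → Matrix (Fin n) (Fin n) ℂ := fun i j =>
    Fin.cons (α := fun _ => Matrix (Fin n) (Fin n) ℂ) (n := u.length) (Matrix.single i j (A l i j))
      (fun p => if p = q then Matrix.single j i (A l j i) else A u[p])
  have hlist (i j : Fin n) : List.ofFn (N i j) = Matrix.single i j (A l i j) ::
      ((u.take q).map A ++ Matrix.single j i (A l j i) :: (u.drop (q + 1)).map A) := by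
    change List.ofFn (n := u.length + 1) (N i j) = _
    rw [List.ofFn_succ]
    refine congrArg₂ List.cons rfl ?_
    refine List.ext_getElem ?_ fun k h1 h2 => ?_
    · have := q.2
      simp
      omega
    · simp only [List.getElem_ofFn, N, Fin.cons_succ]
      have hk : k < u.length := by simpa using h1
      have hq2 := q.2
      rcases lt_trichotomy k q with hlt | heq | hgt
      · rw [if_neg (fun hh => by rw [← hh] at hlt; exact lt_irrefl _ hlt),
          List.getElem_append_left (by simp; omega)]
        simp
      · subst heq
        rw [if_pos rfl, List.getElem_append_right (by simp)]
        simp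
      · rw [if_neg (fun hh => by rw [← hh] at hgt; exact lt_irrefl _ hgt),
          List.getElem_append_right (by simp; omega)]
        obtain ⟨d, rfl⟩ : ∃ d, k = q + 1 + d := ⟨k - (q + 1), by omega⟩
        have : (q : ℕ) + 1 + d - q = d + 1 := by omega
        simp [this]
  have htrace (i j : Fin n) : (List.ofFn (N i j)).prod.trace =
      A l i j * A l j i * wordMat X n (u.take q) ω j j * wordMat X n (u.drop (q + 1)) ω i i := by
    rw [hlist, List.prod_cons, List.prod_append, List.prod_cons, trace_single_mul_mul_single_mul]
    rfl
  have hprod (i j : Fin n) (φ : Fin ((l :: u).length + 1) → Fin n) :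
      ∏ p, N i j p (φ p.castSucc) (φ p.succ) = if φ 0 = i ∧ φ 1 = j then
        (if Returns l u q φ then monomial X (walkEdge (l :: u) φ) ω else 0) else 0 := by
    have hN0 : N i j 0 (φ 0) (φ 1) = if i = φ 0 ∧ j = φ 1 then A l i j else 0 := by
      simp [N, Matrix.single_apply]
    have hNq : N i j (Fin.succ (n := u.length) q) (φ (Fin.castSucc (n := u.length + 1) q.succ))
        (φ (Fin.succ (n := u.length + 1) q.succ)) =
        if j = φ (Fin.castSucc (n := u.length + 1) q.succ) ∧
          i = φ (Fin.succ (n := u.length + 1) q.succ) then A l j i else 0 := by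
      simp [N, Matrix.single_apply]
    by_cases h1 : φ 0 = i ∧ φ 1 = j
    · obtain ⟨rfl, rfl⟩ := h1
      rw [if_pos ⟨rfl, rfl⟩]
      split_ifs with hR
      · refine Finset.prod_congr rfl fun p _ => ?_
        refine Fin.cases ?_ (fun p => ?_) p
        · exact hN0.trans (if_pos ⟨rfl, rfl⟩)
        · by_cases hp : p = q
          · subst hp
            refine (hNq.trans (if_pos ⟨hR.2.1.symm, hR.2.2.symm⟩)).trans ?_
            simp only [A, entMat, Matrix.of_apply]
            rw [← hR.2.1, ← hR.2.2]
            change _ = ent X (u[p], _, _) ω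
            rw [hq]
          · change (if p = q then _ else A u[p]) _ _ = _
            rw [if_neg hp]
            rfl
      · refine Finset.prod_eq_zero (Finset.mem_univ (Fin.succ (n := u.length) q)) ?_
        refine hNq.trans (if_neg fun hh => hR ⟨hq, hh.1.symm, hh.2.symm⟩)
    · rw [if_neg h1]
      refine Finset.prod_eq_zero (Finset.mem_univ (0 : Fin (u.length + 1))) ?_
      exact hN0.trans (if_neg fun hh => h1 ⟨hh.1.symm, hh.2.symm⟩)
  calc _ = ∑ i, ∑ j, (List.ofFn (N i j)).prod.trace := by
        simp only [trace_prod_ofFn, hprod]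
        have (i : Fin n) := Finset.sum_comm (s := (Finset.univ : Finset (Fin n)))
          (t := closedWalks (l :: u).length n)
          (f := fun j φ => if φ 0 = i ∧ φ 1 = j then
            (if Returns l u q φ then monomial X (walkEdge (l :: u) φ) ω else 0) else 0)
        simp only [this]
        rw [Finset.sum_comm]
        refine Finset.sum_congr rfl fun φ _ => ?_
        rw [Finset.sum_eq_single (φ 0) (fun x _ hx => by simp [hx.symm]) (by simp),
          Finset.sum_eq_single (φ 1) (fun x _ hx => by simp [hx.symm]) (by simp)]
        simp
    _ = _ := by
        simp only [htrace, wordMat_diag, Finset.mul_sum, Finset.sum_mul]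
        have (i : Fin n) := Finset.sum_comm (s := (Finset.univ : Finset (Fin n)))
          (t := closedWalks (u.drop (q + 1)).length n)
          (f := fun j ψ => ∑ φ ∈ closedWalks (u.take q).length n,
            A l i j * A l j i * (if φ 0 = j then monomial X (walkEdge (u.take q) φ) ω else 0) *
              if ψ 0 = i then monomial X (walkEdge (u.drop (q + 1)) ψ) ω else 0)
        simp only [this]
        rw [Finset.sum_comm]
        rw [Finset.sum_comm (s := closedWalks (u.take q).length n)]
        refine Finset.sum_congr rfl fun ψ _ => ?_
        rw [Finset.sum_eq_single (ψ 0) (fun x _ hx => by simp [hx.symm]) (by simp),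
          Finset.sum_comm]
        refine Finset.sum_congr rfl fun φ _ => ?_
        rw [Finset.sum_eq_single (φ 0) (fun x _ hx => by simp [hx.symm]) (by simp)]
        simp only [if_true, A, entMat, Matrix.of_apply]
        ring

/-! ### Connectivity of walks -/

lemma walk_apply_eq {w : List (Fin m)} {φ : Fin (w.length + 1) → Fin n} {f : Fin n → ℚ}
    (hf : ∀ p, f (walkEdge w φ p).2.1 = f (walkEdge w φ p).2.2) (v : Fin (w.length + 1)) :
    f (φ v) = f (φ 0) := by
  induction v using Fin.induction with
  | zero => rfl
  | succ p ih => exact (hf p).symm.trans ih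

lemma sum_walk_eq_zero {w : List (Fin m)} {φ : Fin (w.length + 1) → Fin n}
    (hφ : φ ∈ closedWalks w.length n) (f : Fin n → ℚ) :
    ∑ p, (f (walkEdge w φ p).2.2 - f (walkEdge w φ p).2.1) = 0 := by
  simp only [walkEdge]
  have h1 := Fin.sum_univ_succ (fun v => f (φ v))
  have h2 := Fin.sum_univ_castSucc (fun v => f (φ v))
  rw [h1] at h2
  rw [Finset.sum_sub_distrib]
  rw [← mem_closedWalks.1 hφ] at h2
  linarith

end

/-! ### The variance of the trace of a word -/

section

variable {m n : ℕ} {ι ι' : Type*} [Fintype ι] [Fintype ι']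

lemma mult_sumElim (f : ι → Edge m n) (g : ι' → Edge m n) (e : Edge m n) :
    mult (Sum.elim f g) e = mult f e + mult g e := by
  simp only [mult, Finset.card_filter, Fintype.sum_sum_type]
  rfl

lemma mult_pos {f : ι → Edge m n} {e : Edge m n} (h : e ∈ keys f) : 0 < mult f e := by
  obtain ⟨p, hp⟩ := mem_keys.1 h
  exact Finset.card_pos.2 ⟨p, by simpa using hp⟩

lemma Edge.endpoint_of_key_eq {e e' : Edge m n} (h : e.key = e'.key) :
    e.2.1 = e'.2.1 ∨ e.2.1 = e'.2.2 := by
  have h1 := congrArg (fun x : Edge m n => x.2.1) h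
  have h2 := congrArg (fun x : Edge m n => x.2.2) h
  simp only [Edge.key] at h1 h2
  rcases le_total e.2.1 e.2.2 with h3 | h3 <;> rcases le_total e'.2.1 e'.2.2 with h4 | h4 <;>
    simp only [h3, h4, min_eq_left, min_eq_right, max_eq_left, max_eq_right] at h1 h2 <;> tauto

lemma links_sumElim (f : ι → Edge m n) (g : ι' → Edge m n) :
    links (Sum.elim f g) = links f ∪ links g := by
  rw [links, keys_sumElim, Finset.filter_union]
  rfl

/-- A common link is counted once in the union but paid for in both costs; a common loop makes each
cost exceed twice its number of links. -/
lemma two_mul_card_links_sumElim_lt (f : ι → Edge m n) (g : ι' → Edge m n)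
    (h : ¬Disjoint (keys f) (keys g)) :
    2 * (links (Sum.elim f g)).card + 2 ≤ cost f + cost g := by
  rw [links_sumElim]
  obtain ⟨e, he, he'⟩ := Finset.not_disjoint_iff.1 h
  have hf := two_mul_card_links_le f
  have hg := two_mul_card_links_le g
  have hcard := Finset.card_union_add_card_inter (links f) (links g)
  by_cases hl : e.2.1 = e.2.2
  · obtain ⟨p, hp⟩ := mem_keys.1 he
    obtain ⟨q, hq⟩ := mem_keys.1 he'
    have h1 := two_mul_card_links_lt f p (Or.inl ((Edge.key_loop_iff _).1 (by rw [hp, hl])))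
    have h2 := two_mul_card_links_lt g q (Or.inl ((Edge.key_loop_iff _).1 (by rw [hq, hl])))
    omega
  · have : 0 < (links f ∩ links g).card := Finset.card_pos.2 ⟨e, Finset.mem_inter.2
      ⟨Finset.mem_filter.2 ⟨he, hl⟩, Finset.mem_filter.2 ⟨he', hl⟩⟩⟩
    omega

lemma flow_ne_zero_of_mult_eq_one {f : ι → Edge m n} {e : Edge m n} (h : mult f e = 1) :
    flow f (fun _ => 1) e ≠ 0 := by
  obtain ⟨p, hp⟩ := Finset.card_eq_one.1 h
  rw [flow, ← Finset.sum_filter, hp, Finset.sum_singleton, one_mul, Edge.sign]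
  split_ifs <;> norm_num

/-- The labelled edges of a walk, in reversed direction. -/
def revEdge (w : List (Fin m)) (φ : Fin (w.length + 1) → Fin n) (p : Fin w.length) : Edge m n :=
  (w[p], φ p.succ, φ p.castSucc)

/-- The edges of a walk and of a reversed walk. -/
def pairEdge (w : List (Fin m)) (χ : Fin (w.length + 1) ⊕ Fin (w.length + 1) → Fin n) :
    Fin w.length ⊕ Fin w.length → Edge m n :=
  Sum.elim (walkEdge w (χ ∘ Sum.inl)) (revEdge w (χ ∘ Sum.inr))

/-- The pairs of closed walks with a common edge. -/
def linkedPairs (w : List (Fin m)) (n : ℕ) :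
    Finset (Fin (w.length + 1) ⊕ Fin (w.length + 1) → Fin n) :=
  Finset.univ.filter fun χ => χ ∘ Sum.inl ∈ closedWalks w.length n ∧
    χ ∘ Sum.inr ∈ closedWalks w.length n ∧
      ¬Disjoint (keys (walkEdge w (χ ∘ Sum.inl))) (keys (revEdge w (χ ∘ Sum.inr)))

lemma connects_pairEdge {w : List (Fin m)} {χ : Fin (w.length + 1) ⊕ Fin (w.length + 1) → Fin n}
    (h : χ ∈ linkedPairs w n) :
    Connects (pairEdge w χ) {χ (Sum.inl 0)} (Finset.univ.image χ) := by
  intro f hf hR x hx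
  obtain ⟨e, he, he'⟩ := Finset.not_disjoint_iff.1 (Finset.mem_filter.1 h).2.2.2
  obtain ⟨p, hp⟩ := mem_keys.1 he
  obtain ⟨q, hq⟩ := mem_keys.1 he'
  have h0 : f (χ (Sum.inl 0)) = 0 := hR _ (by simp)
  have h1 (v) : f (χ (Sum.inl v)) = f (χ (Sum.inl 0)) :=
    walk_apply_eq (φ := χ ∘ Sum.inl) (fun p => hf (Sum.inl p)) v
  have h2 (v) : f (χ (Sum.inr v)) = f (χ (Sum.inr 0)) :=
    walk_apply_eq (φ := χ ∘ Sum.inr) (fun p => (hf (Sum.inr p)).symm) v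
  have h3 : f (χ (Sum.inr 0)) = f (χ (Sum.inl 0)) := by
    rcases Edge.endpoint_of_key_eq (hp.trans hq.symm) with h4 | h4
    · have := congrArg f h4
      simp only [walkEdge, revEdge, Function.comp] at this
      rw [h1, h2] at this
      exact this.symm
    · have := congrArg f h4
      simp only [walkEdge, revEdge, Function.comp] at this
      rw [h1, h2] at this
      exact this.symm
  obtain ⟨v, -, rfl⟩ := Finset.mem_image.1 hx
  rcases v with v | v
  · rw [h1, h0]
  · rw [h2, h3, h0]

/-- If the common edge has total multiplicity two, each walk uses it once. The circulation along the
first walk alone then has flow `±1` through it. -/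
lemma irregular_pairEdge {w : List (Fin m)} {χ : Fin (w.length + 1) ⊕ Fin (w.length + 1) → Fin n}
    (h : χ ∈ linkedPairs w n) : Irregular (pairEdge w χ) := by
  have hχ := (Finset.mem_filter.1 h).2
  obtain ⟨e, he, he'⟩ := Finset.not_disjoint_iff.1 hχ.2.2
  obtain ⟨p, hp⟩ := mem_keys.1 he
  have hkey : (pairEdge w χ (Sum.inl p)).key = e := hp
  by_cases h2 : mult (pairEdge w χ) e = 2
  · refine Or.inr (Or.inr ⟨Sum.elim (fun _ => 1) (fun _ => 0), fun f => ?_, Sum.inl p, ?_⟩)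
    · rw [Fintype.sum_sum_type]
      simpa [pairEdge] using sum_walk_eq_zero hχ.1 f
    · have h3 := mult_pos he
      have h4 := mult_pos he'
      rw [pairEdge, mult_sumElim] at h2
      have h5 := flow_ne_zero_of_mult_eq_one
        (show mult (walkEdge w (χ ∘ Sum.inl)) e = 1 by omega)
      rw [hkey, flow, Fintype.sum_sum_type]
      simpa [pairEdge, flow] using h5
  · exact Or.inr (Or.inl ⟨Sum.inl p, by rwa [hkey]⟩)

end

/-! ### The variance as a sum over correlated pairs of walks -/

section

variable {Ω : Type*} [MeasurableSpace Ω] {P : Measure Ω} [IsProbabilityMeasure P]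
variable {m n : ℕ} {X : Fin m → ℕ → ℕ → Ω → ℂ}

lemma IsWignerFamily.star_monomial_walkEdge (h : IsWignerFamily P X) (w : List (Fin m))
    (φ : Fin (w.length + 1) → Fin n) (ω : Ω) :
    (starRingEnd ℂ) (monomial X (walkEdge w φ) ω) = monomial X (revEdge w φ) ω := by
  simp only [monomial, map_prod]
  exact Finset.prod_congr rfl fun p _ => h.star_ent _ _ _ _

lemma integral_norm_sub_integral_sq {S : Ω → ℂ} (hm : Measurable S) {B : ℝ}
    (hB : ∀ ω, ‖S ω‖ ≤ B) :
    ((∫ ω, ‖S ω - ∫ ω', S ω' ∂P‖ ^ 2 ∂P : ℝ) : ℂ) =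
      ∫ ω, S ω * (starRingEnd ℂ) (S ω) ∂P - (∫ ω, S ω ∂P) * (starRingEnd ℂ) (∫ ω, S ω ∂P) := by
  set c := ∫ ω, S ω ∂P with hc
  have hS : Integrable S P := Integrable.of_bound hm.aestronglyMeasurable B (Eventually.of_forall hB)
  have hmc : Measurable fun ω => (starRingEnd ℂ) (S ω) := Complex.continuous_conj.measurable.comp hm
  have hSc : Integrable (fun ω => (starRingEnd ℂ) (S ω)) P :=
    Integrable.of_bound hmc.aestronglyMeasurable B
      (Eventually.of_forall fun ω => by simpa using hB ω)
  have hSS : Integrable (fun ω => S ω * (starRingEnd ℂ) (S ω)) P :=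
    hSc.bdd_mul hm.aestronglyMeasurable (Eventually.of_forall hB)
  have h1 : ∀ ω, ((‖S ω - c‖ ^ 2 : ℝ) : ℂ) = S ω * (starRingEnd ℂ) (S ω) -
      (starRingEnd ℂ) c * S ω - c * (starRingEnd ℂ) (S ω) + c * (starRingEnd ℂ) c := by
    intro ω
    rw [← Complex.normSq_eq_norm_sq, ← Complex.mul_conj, map_sub]
    ring
  rw [← integral_complex_ofReal]
  simp only [h1]
  have i1 : Integrable (fun ω => S ω * (starRingEnd ℂ) (S ω) - (starRingEnd ℂ) c * S ω) P :=
    hSS.sub (hS.const_mul _)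
  have i2 : Integrable (fun ω => S ω * (starRingEnd ℂ) (S ω) - (starRingEnd ℂ) c * S ω -
      c * (starRingEnd ℂ) (S ω)) P := i1.sub (hSc.const_mul _)
  rw [integral_add i2 (integrable_const _), integral_sub i1 (hSc.const_mul _),
    integral_sub hSS (hS.const_mul _), integral_const_mul, integral_const_mul, integral_conj,
    ← hc]
  simp
  ring

/-- Conjugation reverses a walk, so the variance is a sum of covariances over pairs. Pairs without a
common undirected edge are independent and cancel exactly. -/
lemma IsWignerFamily.integral_norm_sum_sub_sq_le (h : IsWignerFamily P X) (w : List (Fin m)) :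
    ∫ ω, ‖∑ φ ∈ closedWalks w.length n, monomial X (walkEdge w φ) ω -
        ∫ ω', ∑ φ ∈ closedWalks w.length n, monomial X (walkEdge w φ) ω' ∂P‖ ^ 2 ∂P ≤
      ∑ χ ∈ linkedPairs w n, (‖∫ ω, monomial X (pairEdge w χ) ω ∂P‖ +
        ‖∫ ω, monomial X (walkEdge w (χ ∘ Sum.inl)) ω ∂P‖ *
          ‖∫ ω, monomial X (revEdge w (χ ∘ Sum.inr)) ω ∂P‖) := by
  set K := closedWalks w.length n
  have hm : Measurable fun ω => ∑ φ ∈ K, monomial X (walkEdge w φ) ω :=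
    Finset.measurable_fun_sum _ fun φ _ => h.measurable_monomial _
  have hB (ω : Ω) : ‖∑ φ ∈ K, monomial X (walkEdge w φ) ω‖ ≤ K.card := by
    refine (norm_sum_le _ _).trans ?_
    refine (Finset.sum_le_sum fun φ _ => norm_monomial_le_one (walkEdge w φ) ω).trans ?_
    simp
  have hint (φ : Fin (w.length + 1) → Fin n) : Integrable (monomial X (walkEdge w φ)) P :=
    h.integrable_monomial _
  have hprod (φ ψ : Fin (w.length + 1) → Fin n) :
      Integrable (fun ω => monomial X (walkEdge w φ) ω * monomial X (revEdge w ψ) ω) P := by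
    have := h.integrable_monomial (Sum.elim (walkEdge w φ) (revEdge w ψ))
    exact this.congr (Eventually.of_forall fun ω => monomial_sumElim _ _ ω)
  have key := integral_norm_sub_integral_sq (P := P) hm hB
  rw [integral_finsetSum _ fun φ _ => hint φ] at key ⊢
  have h1 : ∫ ω, (∑ φ ∈ K, monomial X (walkEdge w φ) ω) *
      (starRingEnd ℂ) (∑ φ ∈ K, monomial X (walkEdge w φ) ω) ∂P =
      ∑ φ ∈ K, ∑ ψ ∈ K, ∫ ω, monomial X (walkEdge w φ) ω * monomial X (revEdge w ψ) ω ∂P := by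
    simp only [map_sum, h.star_monomial_walkEdge, Finset.sum_mul_sum]
    rw [integral_finsetSum _ fun φ _ => integrable_finsetSum _ fun ψ _ => hprod φ ψ]
    refine Finset.sum_congr rfl fun φ _ => ?_
    rw [integral_finsetSum _ fun ψ _ => hprod φ ψ]
  have h2 : (∑ φ ∈ K, ∫ ω, monomial X (walkEdge w φ) ω ∂P) *
      (starRingEnd ℂ) (∑ φ ∈ K, ∫ ω, monomial X (walkEdge w φ) ω ∂P) =
      ∑ φ ∈ K, ∑ ψ ∈ K, (∫ ω, monomial X (walkEdge w φ) ω ∂P) *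
        ∫ ω, monomial X (revEdge w ψ) ω ∂P := by
    simp only [map_sum, ← integral_conj, h.star_monomial_walkEdge, Finset.sum_mul_sum]
  rw [h1, h2] at key
  have h3 : ∑ φ ∈ K, ∑ ψ ∈ K, ((∫ ω, monomial X (walkEdge w φ) ω * monomial X (revEdge w ψ) ω ∂P) -
      (∫ ω, monomial X (walkEdge w φ) ω ∂P) * ∫ ω, monomial X (revEdge w ψ) ω ∂P) =
      ∑ χ ∈ linkedPairs w n, ((∫ ω, monomial X (pairEdge w χ) ω ∂P) -
        (∫ ω, monomial X (walkEdge w (χ ∘ Sum.inl)) ω ∂P) *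
          ∫ ω, monomial X (revEdge w (χ ∘ Sum.inr)) ω ∂P) := by
    rw [← Finset.sum_product', linkedPairs, Finset.sum_filter,
      ← (Equiv.sumArrowEquivProdArrow _ _ _).symm.sum_comp, ← Finset.sum_subset
        (Finset.subset_univ (K ×ˢ K))]
    · refine Finset.sum_congr rfl fun φψ hφψ => ?_
      have hmem := Finset.mem_product.1 hφψ
      by_cases hd : Disjoint (keys (walkEdge w φψ.1)) (keys (revEdge w φψ.2))
      · rw [h.integral_monomial_mul _ _ hd, sub_self, if_neg]
        exact fun hh => hh.2.2 hd
      · rw [if_pos ⟨hmem.1, hmem.2, hd⟩]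
        congr 1
        exact integral_congr_ae (Eventually.of_forall fun ω => (monomial_sumElim _ _ ω).symm)
    · intro φψ _ hφψ
      rw [if_neg]
      exact fun hh => hφψ (Finset.mem_product.2 ⟨hh.1, hh.2.1⟩)
  have h5 (a b : (Fin (w.length + 1) → Fin n) → (Fin (w.length + 1) → Fin n) → ℂ) :
      ∑ φ ∈ K, ∑ ψ ∈ K, a φ ψ - ∑ φ ∈ K, ∑ ψ ∈ K, b φ ψ = ∑ φ ∈ K, ∑ ψ ∈ K, (a φ ψ - b φ ψ) := by
    simp only [Finset.sum_sub_distrib]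
  rw [h5, h3] at key
  have h4 := congrArg norm key
  rw [Complex.norm_real, Real.norm_of_nonneg (by positivity)] at h4
  rw [h4]
  refine (norm_sum_le _ _).trans (Finset.sum_le_sum fun χ _ => ?_)
  exact (norm_sub_le _ _).trans (by rw [norm_mul])

/-- The normalized trace of a product of truncated Wigner matrices. -/
def wordTrace (X : Fin m → ℕ → ℕ → Ω → ℂ) (n : ℕ) (w : List (Fin m)) (ω : Ω) : ℂ :=
  normTrace (wordMat X n w ω)

lemma wordTrace_eq (w : List (Fin m)) (ω : Ω) :
    wordTrace X n w ω = 1 / (n : ℂ) * ∑ φ ∈ closedWalks w.length n, monomial X (walkEdge w φ) ω := by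
  rw [wordTrace, normTrace, trace_wordMat]

lemma one_div_sqrt_sq (n : ℕ) : (1 / √(n : ℝ)) ^ 2 = 1 / n := by
  rw [div_pow, Real.sq_sqrt (by positivity), one_pow]

lemma IsWignerFamily.exists_variance_le (h : IsWignerFamily P X) (w : List (Fin m)) :
    ∃ C : ℝ, ∀ n : ℕ, 0 < n →
      ∫ ω, ‖wordTrace X n w ω - ∫ ω', wordTrace X n w ω' ∂P‖ ^ 2 ∂P ≤ C * (1 / √n) ^ 3 := by
  let V := Fin (w.length + 1) ⊕ Fin (w.length + 1)
  let M := momentBound P X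
  let A : ℝ := M ^ Fintype.card (Fin w.length ⊕ Fin w.length)
  let B : ℝ := (Fintype.card V : ℝ) ^ Fintype.card V
  have hM : 0 ≤ M := zero_le_one.trans one_le_momentBound
  refine ⟨A * B + A * B, fun n hn => ?_⟩
  -- Of the four half powers in the squared normalization, two pay for the one base vertex of the
  -- connected pair. The other two and the half power saved give exponent three, hence summability
  -- in `n`.
  have h1 := h.sum_norm_integral_le hn (fun χ : V → Fin n => pairEdge w χ) (linkedPairs w n) 2 1
    fun χ hχ => by
      have := (connects_pairEdge hχ).two_mul_card_lt (irregular_pairEdge hχ)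
      simpa using this
  have h2 := sum_le_of_card_image_le hn (V := V)
    (fun χ => ‖∫ ω, monomial X (walkEdge w (χ ∘ Sum.inl)) ω ∂P‖ *
          ‖∫ ω, monomial X (revEdge w (χ ∘ Sum.inr)) ω ∂P‖) A (by positivity) (linkedPairs w n) 2 1
    (fun χ => cost (walkEdge w (χ ∘ Sum.inl)) + cost (revEdge w (χ ∘ Sum.inr)))
    (fun χ _ => by
      refine (mul_le_mul (h.norm_integral_monomial_le hn _) (h.norm_integral_monomial_le hn _)
        (norm_nonneg _) (by positivity)).trans (le_of_eq ?_)
      simp only [A, Fintype.card_sum, pow_add, M]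
      ring)
    fun χ hχ => by
      have h3 := (connects_pairEdge hχ).card_le
      have h4 := two_mul_card_links_sumElim_lt _ _ (Finset.mem_filter.1 hχ).2.2.2
      rw [pairEdge, Finset.card_singleton] at h3
      omega
  have h3 := h.integral_norm_sum_sub_sq_le (n := n) w
  rw [Finset.sum_add_distrib] at h3
  have h4 : ∫ ω, ‖wordTrace X n w ω - ∫ ω', wordTrace X n w ω' ∂P‖ ^ 2 ∂P =
      (1 / √n) ^ 4 * ∫ ω, ‖∑ φ ∈ closedWalks w.length n, monomial X (walkEdge w φ) ω -
        ∫ ω', ∑ φ ∈ closedWalks w.length n, monomial X (walkEdge w φ) ω' ∂P‖ ^ 2 ∂P := by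
    rw [← integral_const_mul]
    refine integral_congr_ae (Eventually.of_forall fun ω => ?_)
    simp only [wordTrace_eq]
    rw [integral_const_mul, ← mul_sub, norm_mul, mul_pow, show (4 : ℕ) = 2 * 2 from rfl, pow_mul,
      one_div_sqrt_sq]
    simp
  rw [h4]
  calc _ ≤ (1 / √n) ^ 4 * _ := mul_le_mul_of_nonneg_left h3 (by positivity)
    _ = (1 / √n) ^ 2 * ((1 / √n) ^ 2 * (∑ χ ∈ linkedPairs w n, ‖∫ ω, monomial X (pairEdge w χ) ω ∂P‖) +
        (1 / √n) ^ 2 * ∑ χ ∈ linkedPairs w n, ‖∫ ω, monomial X (walkEdge w (χ ∘ Sum.inl)) ω ∂P‖ *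
          ‖∫ ω, monomial X (revEdge w (χ ∘ Sum.inr)) ω ∂P‖) := by ring
    _ ≤ (1 / √n) ^ 2 * (A * B * (1 / √n) ^ 1 + A * B * (1 / √n) ^ 1) :=
        mul_le_mul_of_nonneg_left (add_le_add h1 h2) (by positivity)
    _ = _ := by ring

end

/-! ### The recursion for the expected traces -/

section

variable {m n : ℕ} {ι ι' : Type*} [Fintype ι] [Fintype ι']

lemma Edge.eq_or_eq_swap_of_key_eq {e e' : Edge m n} (h : e.key = e'.key) :
    e' = e ∨ e' = (e.1, e.2.2, e.2.1) := by
  obtain ⟨l, i, j⟩ := e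
  obtain ⟨l', i', j'⟩ := e'
  simp only [Edge.key, Prod.mk.injEq] at h ⊢
  rcases le_total i j with h3 | h3 <;> rcases le_total i' j' with h4 | h4 <;>
    simp only [h3, h4, min_eq_left, min_eq_right, max_eq_left, max_eq_right] at h <;>
    simp [h.1, h.2.1, h.2.2]

/-- If the first edge is not a loop and is used exactly twice, the second use either reverses the
first, giving exactly one return, or repeats its direction. In the latter case the unit circulation
along the closed walk has flow `±2` through it. -/
lemma irregular_of_card_returns_ne_one {l : Fin m} {u : List (Fin m)}
    {φ : Fin ((l :: u).length + 1) → Fin n} (hφ : φ ∈ closedWalks (l :: u).length n)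
    (hne : (Finset.univ.filter fun q => Returns l u q φ).card ≠ 1) :
    Irregular (walkEdge (l :: u) φ) := by
  set edge := walkEdge (l :: u) φ with hedge
  let p₀ : Fin (l :: u).length := (0 : Fin (u.length + 1))
  have hp₀ : edge p₀ = (l, φ 0, φ 1) := rfl
  by_cases hloop : φ 0 = φ 1
  · exact Or.inl ⟨p₀, by rw [hp₀, hloop]⟩
  by_cases hmult : mult edge (edge p₀).key = 2
  swap
  · exact Or.inr (Or.inl ⟨p₀, hmult⟩)
  have hex : ∃ p, p ≠ p₀ ∧ (Finset.univ.filter fun p => (edge p).key = (edge p₀).key) = {p₀, p} := by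
    obtain ⟨x, y, hxy, hs⟩ := Finset.card_eq_two.1 hmult
    have h0 : p₀ ∈ Finset.univ.filter fun p => (edge p).key = (edge p₀).key := by simp
    rw [hs] at h0 ⊢
    rcases Finset.mem_insert.1 h0 with h1 | h1
    · exact ⟨y, fun hh => hxy (h1 ▸ hh.symm), by rw [h1]⟩
    · rw [Finset.mem_singleton] at h1
      exact ⟨x, fun hh => hxy (hh.trans h1), by rw [h1, Finset.pair_comm]⟩
  obtain ⟨p, hp, hs⟩ := hex
  obtain ⟨q, rfl⟩ : ∃ q : Fin u.length, p = Fin.succ (n := u.length) q :=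
    ⟨Fin.pred (n := u.length) p hp, (Fin.succ_pred (n := u.length) p hp).symm⟩
  have hedgeq (q : Fin u.length) : edge (Fin.succ (n := u.length) q) =
    (u[q], φ (Fin.castSucc (n := u.length + 1) q.succ), φ (Fin.succ (n := u.length + 1) q.succ)) := rfl
  have hkeyq : (edge p₀).key = (edge (Fin.succ (n := u.length) q)).key := by
    have : Fin.succ (n := u.length) q ∈
        Finset.univ.filter fun p => (edge p).key = (edge p₀).key := by rw [hs]; simp
    exact (Finset.mem_filter.1 this).2.symm
  rcases Edge.eq_or_eq_swap_of_key_eq hkeyq with h1 | h1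
  · refine Or.inr (Or.inr ⟨fun _ => 1, fun f => ?_, p₀, ?_⟩)
    · simpa using sum_walk_eq_zero hφ f
    · rw [flow, ← Finset.sum_filter, hs, Finset.sum_pair hp.symm, h1, Edge.sign]
      split_ifs <;> norm_num
  · exfalso
    refine hne (Finset.card_eq_one.2 ⟨q, ?_⟩)
    ext q'
    simp only [Finset.mem_filter, Finset.mem_univ, true_and, Finset.mem_singleton]
    rw [hp₀, hedgeq] at h1
    simp only [Prod.mk.injEq] at h1
    constructor
    · intro hR
      have : Fin.succ (n := u.length) q' ∈
          Finset.univ.filter fun p => (edge p).key = (edge p₀).key := by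
        simp only [Finset.mem_filter, Finset.mem_univ, true_and]
        rw [hedgeq, hR.1, hR.2.1, hR.2.2, hp₀]
        exact Edge.key_swap _ _ _
      rw [hs, Finset.mem_insert, Finset.mem_singleton] at this
      rcases this with h2 | h2
      · exact absurd h2 (Fin.succ_ne_zero (n := u.length) q')
      · exact Fin.succ_injective u.length h2
    · rintro rfl
      exact ⟨h1.1, h1.2.1, h1.2.2⟩

/-- The edges of a pair of walks. -/
def twoWalks (v w : List (Fin m)) (χ : Fin (v.length + 1) ⊕ Fin (w.length + 1) → Fin n) :
    Fin v.length ⊕ Fin w.length → Edge m n :=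
  Sum.elim (walkEdge v (χ ∘ Sum.inl)) (walkEdge w (χ ∘ Sum.inr))

/-- The edge between the starting points of two walks, in both directions. -/
def bridgeEdge (l : Fin m) {a b : ℕ} (χ : Fin (a + 1) ⊕ Fin (b + 1) → Fin n) : Fin 2 → Edge m n :=
  ![(l, χ (Sum.inr 0), χ (Sum.inl 0)), (l, χ (Sum.inl 0), χ (Sum.inr 0))]

/-- The pairs of closed walks. -/
def closedPairs (a b n : ℕ) : Finset (Fin (a + 1) ⊕ Fin (b + 1) → Fin n) :=
  Finset.univ.filter fun χ => χ ∘ Sum.inl ∈ closedWalks a n ∧ χ ∘ Sum.inr ∈ closedWalks b n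

/-- The pair of walks meets the edge between its starting points, or the starting points agree. -/
def Touches (l : Fin m) (v w : List (Fin m))
    (χ : Fin (v.length + 1) ⊕ Fin (w.length + 1) → Fin n) : Prop :=
  χ (Sum.inl 0) = χ (Sum.inr 0) ∨ Edge.key (l, χ (Sum.inr 0), χ (Sum.inl 0)) ∈ keys (twoWalks v w χ)

lemma apply_eq_of_twoWalks {v w : List (Fin m)}
    {χ : Fin (v.length + 1) ⊕ Fin (w.length + 1) → Fin n} {f : Fin n → ℚ}
    (hf : ∀ p, f (twoWalks v w χ p).2.1 = f (twoWalks v w χ p).2.2)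
    (h0 : f (χ (Sum.inl 0)) = 0) (h1 : f (χ (Sum.inr 0)) = 0) :
    ∀ x ∈ Finset.univ.image χ, f x = 0 := by
  intro x hx
  obtain ⟨v, -, rfl⟩ := Finset.mem_image.1 hx
  rcases v with v | v
  · exact (walk_apply_eq (φ := χ ∘ Sum.inl) (fun p => hf (Sum.inl p)) v).trans h0
  · exact (walk_apply_eq (φ := χ ∘ Sum.inr) (fun p => hf (Sum.inr p)) v).trans h1

lemma connects_twoWalks (v w : List (Fin m))
    (χ : Fin (v.length + 1) ⊕ Fin (w.length + 1) → Fin n) :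
    Connects (twoWalks v w χ) {χ (Sum.inl 0), χ (Sum.inr 0)} (Finset.univ.image χ) :=
  fun f hf hR => apply_eq_of_twoWalks hf (hR _ (by simp)) (hR _ (by simp))

/-- The two starting points coincide or are already joined by an edge of the walks, so one base
vertex suffices. Compared with `connects_twoWalks` this saves a factor `n`. -/
lemma Touches.connects_twoWalks {l : Fin m} {v w : List (Fin m)}
    {χ : Fin (v.length + 1) ⊕ Fin (w.length + 1) → Fin n} (h : Touches l v w χ) :
    Connects (twoWalks v w χ) {χ (Sum.inl 0)} (Finset.univ.image χ) := by
  intro f hf hR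
  have h0 := hR (χ (Sum.inl 0)) (by simp)
  refine apply_eq_of_twoWalks hf h0 ?_
  rcases h with h | h
  · rw [← h, h0]
  · obtain ⟨p, hp⟩ := mem_keys.1 h
    have h1 := hf p
    rcases Edge.eq_or_eq_swap_of_key_eq hp with h2 | h2
    · rw [← h2] at h1
      exact h1.trans h0
    · have h3 := congrArg (fun e : Edge m n => e.2.1) h2
      have h4 := congrArg (fun e : Edge m n => e.2.2) h2
      simp only at h3 h4
      rw [h3, ← h1, ← h4, h0]

lemma connects_bridge (l : Fin m) (v w : List (Fin m))
    (χ : Fin (v.length + 1) ⊕ Fin (w.length + 1) → Fin n) :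
    Connects (Sum.elim (bridgeEdge l χ) (twoWalks v w χ)) {χ (Sum.inl 0)}
      (Finset.univ.image χ) := by
  intro f hf hR
  have h0 := hR (χ (Sum.inl 0)) (by simp)
  exact apply_eq_of_twoWalks (fun p => hf (Sum.inr p)) h0 ((hf (Sum.inl 0)).trans h0)

lemma key_bridgeEdge (l : Fin m) {a b : ℕ} (χ : Fin (a + 1) ⊕ Fin (b + 1) → Fin n) (p : Fin 2) :
    (bridgeEdge l χ p).key = Edge.key (l, χ (Sum.inr 0), χ (Sum.inl 0)) := by
  fin_cases p
  · rfl
  · exact Edge.key_swap _ _ _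

lemma keys_bridgeEdge (l : Fin m) {a b : ℕ} (χ : Fin (a + 1) ⊕ Fin (b + 1) → Fin n) :
    keys (bridgeEdge l χ) = {Edge.key (l, χ (Sum.inr 0), χ (Sum.inl 0))} := by
  ext e
  simp [mem_keys, key_bridgeEdge, eq_comm]

/-- The bridge is either a loop or, being used twice by itself and again by the walks, has
multiplicity above two. -/
lemma Touches.irregular {l : Fin m} {v w : List (Fin m)}
    {χ : Fin (v.length + 1) ⊕ Fin (w.length + 1) → Fin n} (h : Touches l v w χ) :
    Irregular (Sum.elim (bridgeEdge l χ) (twoWalks v w χ)) := by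
  rcases h with h | h
  · exact Or.inl ⟨Sum.inl 0, h.symm⟩
  · refine Or.inr (Or.inl ⟨Sum.inl 0, ?_⟩)
    have h1 := mult_pos h
    have h2 : mult (bridgeEdge l χ) (Edge.key (l, χ (Sum.inr 0), χ (Sum.inl 0))) = 2 := by
      simp [mult, key_bridgeEdge]
    rw [Sum.elim_inl, key_bridgeEdge, mult_sumElim]
    omega

end

/-! ### Asymptotic factorisation of the expected traces -/

section

variable {Ω : Type*} [MeasurableSpace Ω] {P : Measure Ω} [IsProbabilityMeasure P]
variable {m n : ℕ} {X : Fin m → ℕ → ℕ → Ω → ℂ}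

lemma IsWignerFamily.measurable_wordTrace (h : IsWignerFamily P X) (n : ℕ) (w : List (Fin m)) :
    Measurable (wordTrace X n w) := by
  have : wordTrace X n w = fun ω => 1 / (n : ℂ) *
      ∑ φ ∈ closedWalks w.length n, monomial X (walkEdge w φ) ω := funext fun ω => wordTrace_eq w ω
  rw [this]
  exact (Finset.measurable_fun_sum _ fun φ _ => h.measurable_monomial _).const_mul _

lemma exists_norm_wordTrace_le (n : ℕ) (w : List (Fin m)) :
    ∃ B : ℝ, ∀ ω, ‖wordTrace X n w ω‖ ≤ B := by
  refine ⟨‖1 / (n : ℂ)‖ * (closedWalks w.length n).card, fun ω => ?_⟩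
  rw [wordTrace_eq, norm_mul]
  refine mul_le_mul_of_nonneg_left ((norm_sum_le _ _).trans ?_) (norm_nonneg _)
  refine (Finset.sum_le_sum fun φ _ => norm_monomial_le_one (walkEdge w φ) ω).trans ?_
  simp

lemma IsWignerFamily.integral_wordTrace (h : IsWignerFamily P X) (n : ℕ) (w : List (Fin m)) :
    ∫ ω, wordTrace X n w ω ∂P =
      1 / (n : ℂ) * ∑ φ ∈ closedWalks w.length n, ∫ ω, monomial X (walkEdge w φ) ω ∂P := by
  simp only [wordTrace_eq]
  rw [integral_const_mul, integral_finsetSum _ fun φ _ => h.integrable_monomial _]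

/-- The contribution of the walks whose first step is reversed by the step `q + 1`. -/
def returnSum (P : Measure Ω) (X : Fin m → ℕ → ℕ → Ω → ℂ) (n : ℕ) (l : Fin m) (u : List (Fin m))
    (q : Fin u.length) : ℂ :=
  1 / (n : ℂ) * ∑ φ ∈ closedWalks (l :: u).length n,
    if Returns l u q φ then ∫ ω, monomial X (walkEdge (l :: u) φ) ω ∂P else 0

lemma tendsto_one_div_sqrt : Tendsto (fun n : ℕ => 1 / √(n : ℝ)) atTop (𝓝 0) := by
  simp only [one_div]
  exact (Real.tendsto_sqrt_atTop.comp tendsto_natCast_atTop_atTop).inv_tendsto_atTop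

lemma IsWignerFamily.tendsto_integral_sub_returnSum (h : IsWignerFamily P X) (l : Fin m)
    (u : List (Fin m)) :
    Tendsto (fun n : ℕ => ∫ ω, wordTrace X n (l :: u) ω ∂P - ∑ q, returnSum P X n l u q)
      atTop (𝓝 0) := by
  let w := l :: u
  let C : ℝ := momentBound P X ^ Fintype.card (Fin w.length) *
    (Fintype.card (Fin (w.length + 1)) : ℝ) ^ Fintype.card (Fin (w.length + 1))
  have hlim : Tendsto (fun n : ℕ => (1 + (u.length : ℝ)) * (C * (1 / √(n : ℝ)) ^ 1)) atTop (𝓝 0) := by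
    have := ((tendsto_one_div_sqrt.pow 1).const_mul C).const_mul (1 + (u.length : ℝ))
    simpa using this
  refine squeeze_zero_norm' ?_ hlim
  filter_upwards [eventually_gt_atTop 0] with n hn
  let a : (Fin (w.length + 1) → Fin n) → ℂ := fun φ => ∫ ω, monomial X (walkEdge w φ) ω ∂P
  let N : (Fin (w.length + 1) → Fin n) → ℕ := fun φ =>
    (Finset.univ.filter fun q => Returns l u q φ).card
  -- A walk with `N φ` returns is counted `N φ` times by the return sums, so walks with exactly one
  -- return cancel and the others are irregular.
  have h1 : ∫ ω, wordTrace X n (l :: u) ω ∂P - ∑ q, returnSum P X n l u q =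
      1 / (n : ℂ) * ∑ φ ∈ closedWalks w.length n, (1 - (N φ : ℂ)) * a φ := by
    rw [h.integral_wordTrace]
    simp only [returnSum]
    rw [← Finset.mul_sum, ← mul_sub, Finset.sum_comm, ← Finset.sum_sub_distrib]
    congr 1
    refine Finset.sum_congr rfl fun φ _ => ?_
    rw [← Finset.sum_filter, Finset.sum_const, nsmul_eq_mul, sub_mul, one_mul]
  have hbound := h.sum_norm_integral_le hn (fun φ : Fin (w.length + 1) → Fin n => walkEdge w φ)
    ((closedWalks w.length n).filter fun φ => N φ ≠ 1) 2 1 fun φ hφ => by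
      obtain ⟨hc, hN⟩ := Finset.mem_filter.1 hφ
      have hconn : Connects (walkEdge w φ) {φ 0} (Finset.univ.image φ) := by
        intro f hf hR x hx
        obtain ⟨v, -, rfl⟩ := Finset.mem_image.1 hx
        rw [walk_apply_eq hf v, hR _ (by simp)]
      have := hconn.two_mul_card_lt (irregular_of_card_returns_ne_one hc hN)
      simpa using this
  rw [h1, norm_mul]
  have hN (φ : Fin (w.length + 1) → Fin n) : N φ ≤ u.length :=
    (Finset.card_le_univ _).trans (by simp)
  calc ‖1 / (n : ℂ)‖ * ‖∑ φ ∈ closedWalks w.length n, (1 - (N φ : ℂ)) * a φ‖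
      ≤ (1 / √n) ^ 2 * ∑ φ ∈ (closedWalks w.length n).filter fun φ => N φ ≠ 1,
          (1 + (u.length : ℝ)) * ‖a φ‖ := by
        rw [one_div_sqrt_sq]
        refine mul_le_mul (by simp) ?_ (norm_nonneg _) (by positivity)
        rw [Finset.sum_filter]
        refine (norm_sum_le _ _).trans (Finset.sum_le_sum fun φ _ => ?_)
        split_ifs with hN1
        · rw [norm_mul]
          refine mul_le_mul_of_nonneg_right ?_ (norm_nonneg _)
          refine (norm_sub_le _ _).trans ?_
          have : (N φ : ℝ) ≤ u.length := by exact_mod_cast hN φ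
          simpa using this
        · have : N φ = 1 := not_not.1 hN1
          simp [this]
    _ = (1 + (u.length : ℝ)) * ((1 / √n) ^ 2 *
          ∑ φ ∈ (closedWalks w.length n).filter fun φ => N φ ≠ 1, ‖a φ‖) := by
        rw [← Finset.mul_sum]; ring
    _ ≤ _ := mul_le_mul_of_nonneg_left hbound (by positivity)

lemma sum_closedPairs {a b : ℕ} (F : (Fin (a + 1) → Fin n) → (Fin (b + 1) → Fin n) → ℂ) :
    ∑ φ ∈ closedWalks a n, ∑ ψ ∈ closedWalks b n, F φ ψ =
      ∑ χ ∈ closedPairs a b n, F (χ ∘ Sum.inl) (χ ∘ Sum.inr) := by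
  rw [← Finset.sum_product', closedPairs, Finset.sum_filter,
    ← (Equiv.sumArrowEquivProdArrow _ _ _).symm.sum_comp, ← Finset.sum_subset
      (Finset.subset_univ (closedWalks a n ×ˢ closedWalks b n))]
  · refine Finset.sum_congr rfl fun φψ hφψ => ?_
    have hmem := Finset.mem_product.1 hφψ
    rw [if_pos ⟨hmem.1, hmem.2⟩]
    rfl
  · intro φψ _ hφψ
    rw [if_neg]
    exact fun hh => hφψ (Finset.mem_product.2 ⟨hh.1, hh.2⟩)

lemma IsWignerFamily.returnSum_eq (h : IsWignerFamily P X) (l : Fin m) (u : List (Fin m))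
    (q : Fin u.length) (hq : u[q] = l) :
    returnSum P X n l u q = 1 / (n : ℂ) *
      ∑ χ ∈ closedPairs (u.take q).length (u.drop (q + 1)).length n,
        ∫ ω, monomial X (Sum.elim (bridgeEdge l χ) (twoWalks (u.take q) (u.drop (q + 1)) χ)) ω ∂P := by
  rw [returnSum]
  congr 1
  have h1 : ∑ φ ∈ closedWalks (l :: u).length n,
      (if Returns l u q φ then ∫ ω, monomial X (walkEdge (l :: u) φ) ω ∂P else 0) =
      ∫ ω, ∑ φ ∈ closedWalks (l :: u).length n,
        (if Returns l u q φ then monomial X (walkEdge (l :: u) φ) ω else 0) ∂P := by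
    rw [integral_finsetSum]
    · refine Finset.sum_congr rfl fun φ _ => ?_
      split_ifs <;> simp
    · intro φ _
      split_ifs
      · exact h.integrable_monomial _
      · exact integrable_const _
  rw [h1, ← integral_finsetSum _ fun χ _ => h.integrable_monomial _]
  refine integral_congr_ae (Eventually.of_forall fun ω => ?_)
  simp only
  rw [sum_returns l u q hq ω, sum_closedPairs]
  refine Finset.sum_congr rfl fun χ _ => ?_
  rw [twoWalks, monomial_sumElim, monomial_sumElim]
  simp [monomial, bridgeEdge, Fin.prod_univ_two]

lemma IsWignerFamily.integral_wordTrace_mul (h : IsWignerFamily P X) (v w : List (Fin m)) :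
    ∫ ω, wordTrace X n v ω * wordTrace X n w ω ∂P = (1 / (n : ℂ)) ^ 2 *
      ∑ χ ∈ closedPairs v.length w.length n, ∫ ω, monomial X (twoWalks v w χ) ω ∂P := by
  rw [← integral_finsetSum _ fun χ _ => h.integrable_monomial _, ← integral_const_mul]
  refine integral_congr_ae (Eventually.of_forall fun ω => ?_)
  simp only [wordTrace_eq]
  rw [mul_mul_mul_comm, Finset.sum_mul_sum, sum_closedPairs, ← sq]
  congr 1
  exact Finset.sum_congr rfl fun χ _ => (monomial_sumElim _ _ ω).symm

/-- The bridge is then an off-diagonal entry independent of both walks, and contributes its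
truncated variance divided by `n`. -/
lemma IsWignerFamily.integral_bridge (h : IsWignerFamily P X) {l : Fin m} {v w : List (Fin m)}
    {χ : Fin (v.length + 1) ⊕ Fin (w.length + 1) → Fin n} (hχ : ¬Touches l v w χ) :
    ∫ ω, monomial X (Sum.elim (bridgeEdge l χ) (twoWalks v w χ)) ω ∂P =
      ((1 / n * truncVar P X l n : ℝ) : ℂ) * ∫ ω, monomial X (twoWalks v w χ) ω ∂P := by
  unfold Touches at hχ
  push Not at hχ
  simp only [monomial_sumElim]
  rw [h.integral_monomial_mul, ← h.integral_ent_mul_ent l hχ.1.symm]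
  · simp [monomial, bridgeEdge, Fin.prod_univ_two]
  · rw [keys_bridgeEdge, Finset.disjoint_singleton_left]
    exact hχ.2

lemma IsWignerFamily.tendsto_returnSum_sub (h : IsWignerFamily P X) (l : Fin m) (u : List (Fin m))
    (q : Fin u.length) (hq : u[q] = l) :
    Tendsto (fun n : ℕ => returnSum P X n l u q -
      ∫ ω, wordTrace X n (u.take q) ω * wordTrace X n (u.drop (q + 1)) ω ∂P) atTop (𝓝 0) := by
  classical
  set v := u.take q
  set w := u.drop (q + 1)
  let V := Fin (v.length + 1) ⊕ Fin (w.length + 1)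
  let C₀ : ℝ := momentBound P X ^ Fintype.card (Fin v.length ⊕ Fin w.length) *
    (Fintype.card V : ℝ) ^ Fintype.card V
  let C₁ : ℝ := momentBound P X ^ Fintype.card (Fin 2 ⊕ (Fin v.length ⊕ Fin w.length)) *
    (Fintype.card V : ℝ) ^ Fintype.card V
  have hlim : Tendsto (fun n : ℕ => |truncVar P X l n - 1| * (C₀ * (1 / √(n : ℝ)) ^ 0) +
      (C₁ * (1 / √(n : ℝ)) ^ 1 + (1 / √(n : ℝ)) ^ 2 * (C₀ * (1 / √(n : ℝ)) ^ 0))) atTop (𝓝 0) := by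
    have h1 : Tendsto (fun n : ℕ => |truncVar P X l n - 1| * (C₀ * (1 / √(n : ℝ)) ^ 0))
        atTop (𝓝 0) := by
      have := ((h.tendsto_truncVar l).sub_const 1).abs.mul_const C₀
      simpa using this
    have h2 := (tendsto_one_div_sqrt.pow 1).const_mul C₁
    have h3 := (tendsto_one_div_sqrt.pow 2).mul ((tendsto_one_div_sqrt.pow 0).const_mul C₀)
    simpa using h1.add (h2.add h3)
  refine squeeze_zero_norm' ?_ hlim
  filter_upwards [eventually_gt_atTop 0] with n hn
  let Φ := closedPairs v.length w.length n
  let T := Φ.filter fun χ => Touches l v w χ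
  let b : (V → Fin n) → ℂ := fun χ => ∫ ω, monomial X (twoWalks v w χ) ω ∂P
  let a : (V → Fin n) → ℂ := fun χ =>
    ∫ ω, monomial X (Sum.elim (bridgeEdge l χ) (twoWalks v w χ)) ω ∂P
  -- Three power counts: two base vertices need four half powers; touching pairs need only two,
  -- leaving a factor `1 / n`; touching pairs with the bridge included are irregular and save one
  -- half power.
  have hb := h.sum_norm_integral_le hn (fun χ : V → Fin n => twoWalks v w χ) Φ 4 0 fun χ _ => by
    have h1 := (connects_twoWalks v w χ).two_mul_card_le
    have h2 : ({χ (Sum.inl 0), χ (Sum.inr 0)} : Finset (Fin n)).card ≤ 2 := Finset.card_le_two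
    omega
  have hbT := h.sum_norm_integral_le hn (fun χ : V → Fin n => twoWalks v w χ) T 2 0 fun χ hχ => by
    have h1 := ((Finset.mem_filter.1 hχ).2.connects_twoWalks).two_mul_card_le
    rw [Finset.card_singleton] at h1
    omega
  have haT := h.sum_norm_integral_le hn
    (fun χ : V → Fin n => Sum.elim (bridgeEdge l χ) (twoWalks v w χ)) T 2 1 fun χ hχ => by
      have h1 := (connects_bridge l v w χ).two_mul_card_lt (Finset.mem_filter.1 hχ).2.irregular
      rw [Finset.card_singleton] at h1
      omega
  rw [h.returnSum_eq l u q hq, h.integral_wordTrace_mul]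
  have hn0 : (0 : ℝ) < n := by exact_mod_cast hn
  have hsum : 1 / (n : ℂ) * ∑ χ ∈ Φ, a χ - (1 / (n : ℂ)) ^ 2 * ∑ χ ∈ Φ, b χ =
      ∑ χ ∈ Φ, (1 / (n : ℂ) * a χ - (1 / (n : ℂ)) ^ 2 * b χ) := by
    rw [Finset.sum_sub_distrib, Finset.mul_sum, Finset.mul_sum]
  have hr4 : (1 / √(n : ℝ)) ^ 4 = (1 / n) ^ 2 := by
    rw [show (4 : ℕ) = 2 * 2 from rfl, pow_mul, one_div_sqrt_sq]
  have hterm (χ : V → Fin n) : ‖1 / (n : ℂ) * a χ - (1 / (n : ℂ)) ^ 2 * b χ‖ ≤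
      (1 / √n) ^ 4 * |truncVar P X l n - 1| * ‖b χ‖ +
        if Touches l v w χ then (1 / √n) ^ 2 * ‖a χ‖ + (1 / √n) ^ 4 * ‖b χ‖ else 0 := by
    rw [hr4, one_div_sqrt_sq]
    split_ifs with hχ
    · have h1 : ‖1 / (n : ℂ) * a χ - (1 / (n : ℂ)) ^ 2 * b χ‖ ≤
          1 / n * ‖a χ‖ + (1 / n) ^ 2 * ‖b χ‖ := by
        refine (norm_sub_le _ _).trans (le_of_eq ?_)
        simp
      have h2 : 0 ≤ (1 / (n : ℝ)) ^ 2 * |truncVar P X l n - 1| * ‖b χ‖ := by positivity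
      linarith
    · have h1 : a χ = ((1 / n * truncVar P X l n : ℝ) : ℂ) * b χ := h.integral_bridge hχ
      have h2 : 1 / (n : ℂ) * a χ - (1 / (n : ℂ)) ^ 2 * b χ =
          (((1 / n) ^ 2 * (truncVar P X l n - 1) : ℝ) : ℂ) * b χ := by
        rw [h1]
        push_cast
        ring
      rw [h2, norm_mul, Complex.norm_real, Real.norm_eq_abs, abs_mul,
        abs_of_nonneg (by positivity : (0 : ℝ) ≤ (1 / (n : ℝ)) ^ 2), add_zero]
  calc _ = ‖∑ χ ∈ Φ, (1 / (n : ℂ) * a χ - (1 / (n : ℂ)) ^ 2 * b χ)‖ := congrArg norm hsum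
    _ ≤ ∑ χ ∈ Φ, ((1 / √n) ^ 4 * |truncVar P X l n - 1| * ‖b χ‖ +
        if Touches l v w χ then (1 / √n) ^ 2 * ‖a χ‖ + (1 / √n) ^ 4 * ‖b χ‖ else 0) :=
        (norm_sum_le _ _).trans (Finset.sum_le_sum fun χ _ => hterm χ)
    _ = |truncVar P X l n - 1| * ((1 / √n) ^ 4 * ∑ χ ∈ Φ, ‖b χ‖) +
        ((1 / √n) ^ 2 * ∑ χ ∈ T, ‖a χ‖ + (1 / √n) ^ 2 * ((1 / √n) ^ 2 * ∑ χ ∈ T, ‖b χ‖)) := by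
        rw [Finset.sum_add_distrib, ← Finset.mul_sum, ← Finset.sum_filter, Finset.sum_add_distrib,
          ← Finset.mul_sum, ← Finset.mul_sum]
        ring
    _ ≤ _ := add_le_add (mul_le_mul_of_nonneg_left hb (abs_nonneg _))
        (add_le_add haT (mul_le_mul_of_nonneg_left hbT (by positivity)))

/-- The left side is the covariance of `S` and `T`, and `x y ≤ x ^ 2 + y ^ 2`. Vanishing variances
thus make expectations of products factorise in the limit. -/
lemma norm_integral_mul_sub_le {S T : Ω → ℂ} (hS : Measurable S) (hT : Measurable T) {A B : ℝ}
    (hA : ∀ ω, ‖S ω‖ ≤ A) (hB : ∀ ω, ‖T ω‖ ≤ B) :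
    ‖∫ ω, S ω * T ω ∂P - (∫ ω, S ω ∂P) * ∫ ω, T ω ∂P‖ ≤
      ∫ ω, ‖S ω - ∫ ω', S ω' ∂P‖ ^ 2 ∂P + ∫ ω, ‖T ω - ∫ ω', T ω' ∂P‖ ^ 2 ∂P := by
  set s := ∫ ω, S ω ∂P with hs
  set t := ∫ ω, T ω ∂P with ht
  have iS : Integrable S P := Integrable.of_bound hS.aestronglyMeasurable A (Eventually.of_forall hA)
  have iT : Integrable T P := Integrable.of_bound hT.aestronglyMeasurable B (Eventually.of_forall hB)
  have iST : Integrable (fun ω => S ω * T ω) P :=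
    iT.bdd_mul hS.aestronglyMeasurable (Eventually.of_forall hA)
  have hsq {S : Ω → ℂ} (hS : Measurable S) {A : ℝ} (hA : ∀ ω, ‖S ω‖ ≤ A) (s : ℂ) :
      Integrable (fun ω => ‖S ω - s‖ ^ 2) P := by
    refine Integrable.of_bound ((hS.sub_const s).norm.pow_const 2).aestronglyMeasurable
      ((A + ‖s‖) ^ 2) (Eventually.of_forall fun ω => ?_)
    rw [Real.norm_of_nonneg (by positivity)]
    exact pow_le_pow_left₀ (norm_nonneg _) ((norm_sub_le _ _).trans (by linarith [hA ω])) 2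
  have h1 : ∫ ω, S ω * T ω ∂P - s * t = ∫ ω, (S ω - s) * (T ω - t) ∂P := by
    have h2 : ∀ ω, (S ω - s) * (T ω - t) = S ω * T ω - t * S ω - (s * T ω - s * t) := fun ω => by ring
    simp only [h2]
    have i1 : Integrable (fun ω => S ω * T ω - t * S ω) P := iST.sub (iS.const_mul _)
    have i2 : Integrable (fun ω => s * T ω - s * t) P := (iT.const_mul _).sub (integrable_const _)
    rw [integral_sub i1 i2, integral_sub iST (iS.const_mul _),
      integral_sub (iT.const_mul _) (integrable_const _), integral_const_mul, integral_const_mul,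
      ← hs, ← ht]
    simp
    ring
  rw [h1, ← integral_add (hsq hS hA s) (hsq hT hB t)]
  refine norm_integral_le_of_norm_le ((hsq hS hA s).add (hsq hT hB t))
    (Eventually.of_forall fun ω => ?_)
  rw [norm_mul]
  nlinarith [sq_nonneg (‖S ω - s‖ - ‖T ω - t‖), sq_nonneg ‖S ω - s‖, sq_nonneg ‖T ω - t‖]

lemma IsWignerFamily.tendsto_variance (h : IsWignerFamily P X) (w : List (Fin m)) :
    Tendsto (fun n : ℕ => ∫ ω, ‖wordTrace X n w ω - ∫ ω', wordTrace X n w ω' ∂P‖ ^ 2 ∂P)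
      atTop (𝓝 0) := by
  obtain ⟨C, hC⟩ := h.exists_variance_le w
  have hlim : Tendsto (fun n : ℕ => C * (1 / √(n : ℝ)) ^ 3) atTop (𝓝 0) := by
    simpa using (tendsto_one_div_sqrt.pow 3).const_mul C
  refine squeeze_zero' (Eventually.of_forall fun n => by positivity) ?_ hlim
  filter_upwards [eventually_gt_atTop 0] with n hn using hC n hn

lemma IsWignerFamily.tendsto_integral_mul_sub (h : IsWignerFamily P X) (v w : List (Fin m)) :
    Tendsto (fun n : ℕ => ∫ ω, wordTrace X n v ω * wordTrace X n w ω ∂P -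
      (∫ ω, wordTrace X n v ω ∂P) * ∫ ω, wordTrace X n w ω ∂P) atTop (𝓝 0) := by
  have hlim := (h.tendsto_variance v).add (h.tendsto_variance w)
  rw [add_zero] at hlim
  refine squeeze_zero_norm (fun n => ?_) hlim
  obtain ⟨A, hA⟩ := exists_norm_wordTrace_le (X := X) n v
  obtain ⟨B, hB⟩ := exists_norm_wordTrace_le (X := X) n w
  exact norm_integral_mul_sub_le (h.measurable_wordTrace n v) (h.measurable_wordTrace n w) hA hB

/-- The expected traces of words converge to the vacuum moments of semicircular operators. -/
lemma IsWignerFamily.tendsto_integral_wordTrace (h : IsWignerFamily P X) (w : List (Fin m)) :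
    Tendsto (fun n : ℕ => ∫ ω, wordTrace X n w ω ∂P) atTop (𝓝 (fockCoeff w [])) := by
  induction hk : w.length using Nat.strong_induction_on generalizing w with
  | _ k ih =>
    rcases w with _ | ⟨l, u⟩
    · rw [fockCoeff_nil, if_pos rfl]
      refine tendsto_const_nhds.congr' ?_
      filter_upwards [eventually_gt_atTop 0] with n hn
      have : (n : ℂ) ≠ 0 := by exact_mod_cast hn.ne'
      simp [wordTrace, normTrace, wordMat, this]
    -- Both sides are now sums over the position `q` of the letter paired with the leading `l`; the
    -- limits agree term by term by induction on the two shorter words.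
    · rw [fockCoeff_cons_nil, fockCoeff_cons_eq_splitSum, splitSum_eq_sum]
      have hq (q : Fin u.length) : Tendsto (fun n : ℕ => returnSum P X n l u q) atTop
          (𝓝 (if u[q] = l then fockCoeff (u.take q) [] * fockCoeff (u.drop (q + 1)) [] else 0)) := by
        split_ifs with hq
        · have h1 := h.tendsto_returnSum_sub l u q hq
          have h2 := h.tendsto_integral_mul_sub (u.take q) (u.drop (q + 1))
          have hql := q.2
          have h3 := ih _ (by simp at hk ⊢; omega) (u.take q) rfl
          have h4 := ih _ (by simp at hk ⊢; omega) (u.drop (q + 1)) rfl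
          have h5 := (h1.add h2).add (h3.mul h4)
          simpa using h5
        · have : ∀ n : ℕ, returnSum P X n l u q = 0 := fun n => by
            rw [returnSum, Finset.sum_eq_zero, mul_zero]
            intro φ _
            rw [if_neg fun hR => hq hR.1]
          simp only [this]
          exact tendsto_const_nhds
      have h1 := (h.tendsto_integral_sub_returnSum l u).add
        (tendsto_finsetSum Finset.univ fun q _ => hq q)
      simpa using h1

end

/-! ### Almost sure convergence -/

section

variable {Ω : Type*} [MeasurableSpace Ω] {P : Measure Ω} [IsProbabilityMeasure P]
variable {m : ℕ} {X : Fin m → ℕ → ℕ → Ω → ℂ}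

/-- With `t = ‖X l 0 1 ω‖ ^ 2` this turns a sum over the columns of the array into the fourth
moment. -/
lemma tsum_lt_le_sq {t : ℝ} (ht : 0 ≤ t) :
    ∑' j : ℕ, (if (j : ℝ) < t then (j : ENNReal) else 0) ≤ ENNReal.ofReal (t ^ 2) := by
  rw [tsum_eq_sum (s := Finset.range ⌈t⌉₊)]
  · calc _ ≤ ∑ j ∈ Finset.range ⌈t⌉₊, (j : ENNReal) :=
          Finset.sum_le_sum fun j _ => by split_ifs <;> simp
      _ = ENNReal.ofReal ((∑ j ∈ Finset.range ⌈t⌉₊, j : ℕ) : ℝ) := by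
          rw [ENNReal.ofReal_natCast]; push_cast; rfl
      _ ≤ _ := by
          refine ENNReal.ofReal_le_ofReal ?_
          have h1 := Finset.sum_range_id_mul_two ⌈t⌉₊
          have h2 := Nat.ceil_lt_add_one ht
          rcases hN : ⌈t⌉₊ with _ | _ | N
          · simp; positivity
          · simp; positivity
          · rw [hN] at h1 h2
            have h3 : ((∑ j ∈ Finset.range (N + 1 + 1), j : ℕ) : ℝ) * 2 = (N + 1 + 1) * (N + 1) := by
              exact_mod_cast h1
            push_cast at h2 h3 ⊢
            nlinarith [(Nat.cast_nonneg N : (0 : ℝ) ≤ N)]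
  · intro j hj
    rw [if_neg]
    intro h
    exact hj (Finset.mem_range.2 (Nat.lt_ceil.2 h))

/-- Borel–Cantelli over the entries, each compared with its own column index instead of the matrix
size. Column `j` has `j` entries above the diagonal, so the total probability is at most the fourth
moment. -/
lemma IsWignerFamily.ae_finite_upper (h : IsWignerFamily P X) (l : Fin m) :
    ∀ᵐ ω ∂P, {q : (j : ℕ) × Fin j | (q.1 : ℝ) < ‖X l q.2 q.1 ω‖ ^ 2}.Finite := by
  refine ae_finite_setOfPred_mem (s := fun q : (j : ℕ) × Fin j => {ω | (q.1 : ℝ) < ‖X l q.2 q.1 ω‖ ^ 2}) ?_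
  have hmeas : Measurable (X l 0 1) := (h.wigner l).measurable _ _
  have hset (j : ℕ) : MeasurableSet {z : ℂ | (j : ℝ) < ‖z‖ ^ 2} :=
    measurableSet_lt measurable_const (by fun_prop)
  have h1 (j : ℕ) (i : Fin j) : P {ω | (j : ℝ) < ‖X l i j ω‖ ^ 2} =
      P {ω | (j : ℝ) < ‖X l 0 1 ω‖ ^ 2} :=
    ((h.wigner l).ident_upper i j i.2).measure_mem_eq (hset j)
  rw [ENNReal.tsum_sigma']
  simp only [h1]
  have h2 (j : ℕ) : ∑' _ : Fin j, P {ω | (j : ℝ) < ‖X l 0 1 ω‖ ^ 2} =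
      ∫⁻ ω, (if (j : ℝ) < ‖X l 0 1 ω‖ ^ 2 then (j : ENNReal) else 0) ∂P := by
    rw [tsum_fintype, Finset.sum_const, nsmul_eq_mul, Finset.card_univ, Fintype.card_fin]
    refine (lintegral_indicator_const (μ := P) (hmeas (hset j)) (j : ENNReal)).symm.trans
      (lintegral_congr fun ω => ?_)
    simp [Set.indicator_apply]
  simp only [h2]
  rw [← lintegral_tsum]
  · refine ((lintegral_mono fun ω => tsum_lt_le_sq (by positivity)).trans_lt ?_).ne
    have := (h.integrable_pow l (le_refl 4)).lintegral_lt_top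
    simpa only [← pow_mul] using this
  · intro j
    exact (Measurable.ite (hmeas (hset j)) measurable_const measurable_const).aemeasurable

lemma IsWignerFamily.ae_finite_diag (h : IsWignerFamily P X) (l : Fin m) :
    ∀ᵐ ω ∂P, {i : ℕ | (i : ℝ) < ‖X l i i ω‖ ^ 2}.Finite := by
  refine ae_finite_setOfPred_mem (s := fun i : ℕ => {ω | (i : ℝ) < ‖X l i i ω‖ ^ 2}) ?_
  have hset (j : ℕ) : MeasurableSet {z : ℂ | (j : ℝ) < ‖z‖ ^ 2} :=
    measurableSet_lt measurable_const (by fun_prop)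
  have h1 (i : ℕ) : P {ω | (i : ℝ) < ‖X l i i ω‖ ^ 2} = P {ω | (i : ℝ) < ‖X l 0 0 ω‖ ^ 2} :=
    ((h.wigner l).ident_diag i).measure_mem_eq (hset i)
  simp only [h1]
  let _ : MeasureSpace Ω := ⟨P⟩
  exact (tsum_prob_mem_Ioi_lt_top (X := fun ω => ‖X l 0 0 ω‖ ^ 2)
    (h.integrable_pow_diag l (le_refl 2)) (fun ω => by positivity)).ne

/-- Almost surely, the truncation eventually has no effect. -/
lemma IsWignerFamily.ae_eventually_norm_le (h : IsWignerFamily P X) :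
    ∀ᵐ ω ∂P, ∀ᶠ n : ℕ in atTop, ∀ l, ∀ i j : Fin n, ‖X l i j ω‖ ≤ √n := by
  filter_upwards [ae_all_iff.2 h.ae_finite_upper, ae_all_iff.2 h.ae_finite_diag] with ω h1 h2
  rw [eventually_all]
  intro l
  -- The finitely many exceptional entries have a common bound, which `n` eventually exceeds. Every
  -- other entry of the matrix is controlled by its column index, which is below `n`.
  obtain ⟨A, hA⟩ := ((h1 l).image fun q => ‖X l q.2 q.1 ω‖ ^ 2).bddAbove
  obtain ⟨B, hB⟩ := ((h2 l).image fun i => ‖X l i i ω‖ ^ 2).bddAbove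
  have hcast := tendsto_natCast_atTop_atTop (R := ℝ)
  filter_upwards [hcast.eventually_ge_atTop A, hcast.eventually_ge_atTop B] with n hnA hnB
  have hlt (i j : Fin n) (hij : i < j) : ‖X l i j ω‖ ≤ √n := by
    refine Real.le_sqrt_of_sq_le ?_
    by_cases hq : ((j : ℕ) : ℝ) < ‖X l i j ω‖ ^ 2
    · exact (hA ⟨⟨j, ⟨i, hij⟩⟩, hq, rfl⟩).trans hnA
    · exact (not_lt.1 hq).trans (by exact_mod_cast j.2.le)
  intro i j
  rcases lt_trichotomy i j with hij | rfl | hij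
  · exact hlt i j hij
  · refine Real.le_sqrt_of_sq_le ?_
    by_cases hq : ((i : ℕ) : ℝ) < ‖X l i i ω‖ ^ 2
    · exact (hB ⟨(i : ℕ), hq, rfl⟩).trans hnB
    · exact (not_lt.1 hq).trans (by exact_mod_cast i.2.le)
  · rw [(h.wigner l).hermitian, norm_star]
    exact hlt j i hij

/-- The series of squared deviations has finite expectation, so it converges almost surely and its
terms tend to zero. No relation between different `n` is needed. -/
lemma tendsto_ae_of_summable_integral_norm_sub_sq {S : ℕ → Ω → ℂ} (hS : ∀ n, Measurable (S n))
    (hB : ∀ n, ∃ B : ℝ, ∀ ω, ‖S n ω‖ ≤ B) {c : ℂ}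
    (hsum : Summable fun n => ∫ ω, ‖S n ω - ∫ ω', S n ω' ∂P‖ ^ 2 ∂P)
    (hc : Tendsto (fun n => ∫ ω, S n ω ∂P) atTop (𝓝 c)) :
    ∀ᵐ ω ∂P, Tendsto (fun n => S n ω) atTop (𝓝 c) := by
  let V : ℕ → Ω → ℝ := fun n ω => ‖S n ω - ∫ ω', S n ω' ∂P‖ ^ 2
  have hV (n : ℕ) : Measurable (V n) := ((hS n).sub_const _).norm.pow_const 2
  have hVi (n : ℕ) : Integrable (V n) P := by
    obtain ⟨B, hB⟩ := hB n
    refine Integrable.of_bound (hV n).aestronglyMeasurable ((B + ‖∫ ω', S n ω' ∂P‖) ^ 2)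
      (Eventually.of_forall fun ω => ?_)
    rw [Real.norm_of_nonneg (by positivity)]
    exact pow_le_pow_left₀ (norm_nonneg _) ((norm_sub_le _ _).trans (by linarith [hB ω])) 2
  have h1 : ∫⁻ ω, ∑' n, ENNReal.ofReal (V n ω) ∂P ≠ ⊤ := by
    rw [lintegral_tsum fun n => (hV n).ennreal_ofReal.aemeasurable]
    have : ∀ n, ∫⁻ ω, ENNReal.ofReal (V n ω) ∂P = ENNReal.ofReal (∫ ω, V n ω ∂P) := fun n =>
      (ofReal_integral_eq_lintegral_ofReal (hVi n) (Eventually.of_forall fun ω => by positivity)).symm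
    simp only [this]
    exact hsum.tsum_ofReal_ne_top
  filter_upwards [ae_lt_top (Measurable.tsum fun n => (hV n).ennreal_ofReal) h1] with ω hω
  have h2 := ENNReal.tendsto_atTop_zero_of_tsum_ne_top hω.ne
  have h3 := (ENNReal.tendsto_toReal ENNReal.zero_ne_top).comp h2
  have h4 : Tendsto (fun n => V n ω) atTop (𝓝 0) := by
    refine h3.congr fun n => ?_
    exact ENNReal.toReal_ofReal (by positivity)
  have h5 : Tendsto (fun n => ‖S n ω - ∫ ω', S n ω' ∂P‖) atTop (𝓝 0) := by
    have := h4.sqrt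
    simpa [V, Real.sqrt_sq] using this
  have h6 := (tendsto_zero_iff_norm_tendsto_zero.2 h5).add hc
  simpa using h6

lemma IsWignerFamily.tendsto_wordTrace (h : IsWignerFamily P X) (w : List (Fin m)) :
    ∀ᵐ ω ∂P, Tendsto (fun n => wordTrace X n w ω) atTop (𝓝 (fockCoeff w [])) := by
  refine tendsto_ae_of_summable_integral_norm_sub_sq (fun n => h.measurable_wordTrace n w)
    (fun n => exists_norm_wordTrace_le n w) ?_ (h.tendsto_integral_wordTrace w)
  obtain ⟨C, hC⟩ := h.exists_variance_le w
  have h1 : Summable fun n : ℕ => C * (1 / √(n : ℝ)) ^ 3 := by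
    refine Summable.mul_left C ?_
    have h2 := Real.summable_one_div_nat_rpow.2 (by norm_num : (1 : ℝ) < 3 / 2)
    refine h2.congr fun n => ?_
    rw [div_pow, one_pow, Real.sqrt_eq_rpow, ← Real.rpow_mul_natCast (by positivity)]
    norm_num
  -- The shift by one avoids `n = 0`, where the variance bound is not available.
  refine (summable_nat_add_iff 1).1 (Summable.of_nonneg_of_le (fun n => by positivity)
    (fun n => hC (n + 1) n.succ_pos) ((summable_nat_add_iff 1).2 h1))

/-! ### From words to noncommutative polynomials -/

lemma wignerMatrix_eq_entMat {n : ℕ} {ω : Ω} (h : ∀ l, ∀ i j : Fin n, ‖X l i j ω‖ ≤ √n) (l : Fin m) :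
    wignerMatrix (X l) n ω = entMat X n ω l := by
  ext i j
  simp [wignerMatrix, entMat, ent, trunc, h l i j]

lemma mem_span_words (p : FreeAlgebra ℂ (Fin m)) :
    p ∈ Submodule.span ℂ (Set.range fun w : List (Fin m) => (w.map (FreeAlgebra.ι ℂ)).prod) := by
  have h1 : p ∈ (Algebra.adjoin ℂ (Set.range (FreeAlgebra.ι ℂ (X := Fin m)))).toSubmodule := by
    rw [FreeAlgebra.adjoin_range_ι]
    trivial
  rw [Algebra.adjoin_eq_span] at h1
  refine Submodule.span_mono ?_ h1
  intro x hx
  induction hx using Submonoid.closure_induction with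
  | mem x hx =>
    obtain ⟨l, rfl⟩ := hx
    exact ⟨[l], by simp⟩
  | one => exact ⟨[], by simp⟩
  | mul x y _ _ hx hy =>
    obtain ⟨v, rfl⟩ := hx
    obtain ⟨w, rfl⟩ := hy
    exact ⟨v ++ w, by simp⟩

lemma lift_word {A : Type*} [Semiring A] [Algebra ℂ A] (a : Fin m → A) (w : List (Fin m)) :
    FreeAlgebra.lift ℂ a (w.map (FreeAlgebra.ι ℂ)).prod = (w.map a).prod := by
  rw [map_list_prod, List.map_map]
  congr 2
  funext l
  simp

lemma normTrace_add {n : ℕ} (A B : Matrix (Fin n) (Fin n) ℂ) :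
    normTrace (A + B) = normTrace A + normTrace B := by
  simp [normTrace, mul_add]

lemma normTrace_smul {n : ℕ} (c : ℂ) (A : Matrix (Fin n) (Fin n) ℂ) :
    normTrace (c • A) = c * normTrace A := by
  simp [normTrace]
  ring

/-- Almost sure convergence of all mixed moments of a family of independent Wigner matrices. -/
lemma IsWignerFamily.tendsto_normTrace_lift (h : IsWignerFamily P X) (p : FreeAlgebra ℂ (Fin m)) :
    ∀ᵐ ω ∂P, Tendsto (fun n : ℕ => normTrace
      (FreeAlgebra.lift ℂ (fun l => wignerMatrix (X l) n ω) p)) atTop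
      (𝓝 (vacuumState (Fin m) (FreeAlgebra.lift ℂ fockSemicircular p))) := by
  refine Submodule.span_induction ?_ ?_ ?_ ?_ (mem_span_words p)
  · rintro _ ⟨w, rfl⟩
    filter_upwards [h.tendsto_wordTrace w, h.ae_eventually_norm_le] with ω h1 h2
    rw [lift_word, vacuumState_prod]
    refine h1.congr' ?_
    -- For large `n` the truncated and original matrices of this sample point coincide.
    filter_upwards [h2] with n hn
    rw [lift_word, wordTrace, wordMat]
    simp only [wignerMatrix_eq_entMat hn]
  · refine Eventually.of_forall fun ω => ?_
    simp [normTrace]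
  · intro p q _ _ hp hq
    filter_upwards [hp, hq] with ω h1 h2
    simpa only [map_add, normTrace_add] using h1.add h2
  · intro c p _ hp
    filter_upwards [hp] with ω h1
    simpa only [map_smul, normTrace_smul, smul_eq_mul] using h1.const_mul c

end

end FreeProb

end

theorem theorem2 {Ω : Type*} [MeasurableSpace Ω] (P : Measure Ω) [IsProbabilityMeasure P]
    (m : ℕ) (X : Fin m → ℕ → ℕ → Ω → ℂ)
    (hX : ∀ l, FreeProb.IsWignerArray P (X l) 1)
    (hindep : iIndepFun (fun (l : Fin m) (ω : Ω) (i j : ℕ) => X l i j ω) P)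
    (hoff : ∀ l, MemLp (X l 0 1) 4 P)
    (hdiag : ∀ l, MemLp (X l 0 0) 2 P) :
    ∃ (𝒜 : Type) (_ : Ring 𝒜) (_ : StarRing 𝒜) (_ : Algebra ℂ 𝒜) (_ : StarModule ℂ 𝒜)
      (τ : 𝒜 →ₗ[ℂ] ℂ) (a : Fin m → 𝒜),
      FreeProb.IsState τ ∧
      FreeProb.FreeVariables τ a ∧
      (∀ l, FreeProb.HasDistribution τ (a l) (FreeProb.semicircleLaw 0 1)) ∧
      ∀ p : FreeAlgebra ℂ (Fin m), ∀ᵐ ω ∂P,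
        Tendsto
          (fun n : ℕ => FreeProb.normTrace
            (FreeAlgebra.lift ℂ (fun l => FreeProb.wignerMatrix (X l) n ω) p))
          atTop (𝓝 (τ (FreeAlgebra.lift ℂ a p))) :=
  ⟨FreeProb.Fock (Fin m) →L[ℂ] FreeProb.Fock (Fin m), inferInstance, inferInstance, inferInstance,
    inferInstance, FreeProb.vacuumState (Fin m), FreeProb.fockSemicircular,
    FreeProb.isState_vacuumState, FreeProb.freeVariables_fockSemicircular,
    FreeProb.hasDistribution_fockSemicircular,
    fun p => FreeProb.IsWignerFamily.tendsto_normTrace_lift ⟨hX, hindep, hoff, hdiag⟩ p⟩
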